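/- **Algorithm.** Let $\Theta\subset\mathbb R^d$ be a model class, $\theta^\star\in\Theta$ an unknown ground truth, $\eta(\theta,a)$ a deterministic reward on an action set $\mathcal A\subset\mathbb R^d$, and $\tilde\eta(\theta,a)=\eta(\theta,a)-\frac c2\|a\|_2^2$ a regularized reward. Let $B,\zeta_g,\zeta_h$ be constants such that $|\tilde\eta(\theta,a)|\le B$, $\|\nabla_a\tilde\eta(\theta,a)\|_2\le\zeta_g$ and $\|\nabla_a^2\tilde\eta(\theta,a)\|_{\rm sp}\le\zeta_h$ for all $\theta\in\Theta$ and $\|a\|_2\le 2$. (In all three cases below $B=4$, $\zeta_g=3$, $\zeta_h=1$ are valid.) Put $\kappa_1=2\zeta_g$, $\kappa_2=640\sqrt2\,\zeta_h$. For $x=(a,a',u,v)$ let $$\hat y(\theta,x)=\big[\tilde\eta(\theta,a),\ \tilde\eta(\theta,a'),\ \langle\nabla_a\tilde\eta(\theta,a'),u\rangle,\ \langle\nabla_a^2\tilde\eta(\theta,a')u,v\rangle\big]\in\mathbb R^4,$$ $$\ell((x,y);\theta)=\sum_{i=1}^{2}([\hat y]_i-[y]_i)^2+\min\big(\kappa_1^2,([\hat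 y]_3-[y]_3)^2\big)+\min\big(\kappa_2^2,([\hat y]_4-[y]_4)^2\big).$$ An online learner $\mathcal R$ maps each finite history of pairs $(x,y)$ measurably to a probability distribution on $\Theta$. The algorithm starts with any $a_0\in\mathcal A$; in round $t\ge1$ it computes $p_t=\mathcal R((x_1,y_1),\dots,(x_{t-1},y_{t-1}))$, plays $a_t\in\arg\max_{a\in\mathbb R^d}\mathbb E_{\theta\sim p_t}[\tilde\eta(\theta,a)]$, draws independent $u_t,v_t\sim\mathcal N(0,I_d)$, and adds the data point $x_t=(a_t,a_{t-1},u_t,v_t)$, $y_t=\hat y(\theta^\star,x_t)$ to the history. Its global regret is $\mathrm{reg}(T)=\sum_{t=1}^T\big(\sup_{a\in\mathcal A}\eta(\theta^\star,a)-\eta(\theta^\star,a_t)\big)$. **Online guarantee.** Consider the online prediction game over $T$ rounds in which, in round $t$, the learner outputs $p_t$, nature selects $\bar x_t=(a,a')$ with $\|a\|_2,\|a'\|_2\le2$, the noise $\xi_t=(u_t,v_t)$ is drawn, and nature selects a label $y_t\in\mathbb R^4$ with $|[y_t]_1|,|[y_t]_2|\le B$. The learner satisfies the guarantee at horizon $T$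 if against every nature $$\mathbb E\Big[\sum_{t=1}^T\ell((x_t,y_t);\theta_t)-\inf_{\theta\in\Theta}\sum_{t=1}^T\ell((x_t,y_t);\theta)\Big]\le2\,\mathfrak R_T,\qquad \theta_t\sim p_t,\quad x_t=(\bar x_t,\xi_t),$$ where $\mathfrak R_T=\sup\mathbb E_{\xi}\mathbb E_{\epsilon}\big[\sup_{\theta\in\Theta}\sum_{t=1}^T\epsilon_t\,\ell((x_t,y_t);\theta)\big]$ is the sequential Rademacher complexity: $\epsilon_1,\dots,\epsilon_T$ are independent uniform signs, and the outer supremum is over all trees that choose $\bar x_t$ (in the same domain) from $\epsilon_1,\dots,\epsilon_{t-1},\xi_1,\dots,\xi_{t-1}$ and $y_t$ (in the same label set) from $\epsilon_1,\dots,\epsilon_{t-1},\xi_1,\dots,\xi_t$. **Claim.** In each of the following cases there is a constant $C$ depending only on $B,\zeta_g,\zeta_h$ (not on $d$, $\Theta$, $\theta^\star$, $T$, $s$, $\mathcal R$, $a_0$ or the choice of the maximizers) such that for every $T$ the algorithm run with any online learner that satisfies the guarantee at horizon $T$ has the stated bound on its expected global regret, for every $\theta^\star\in\Theta$ and $a_0\in\mathcal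 A$. Moreover, for every $T$ there is an online learner with which the algorithm has the stated bound for every $\theta^\star\in\Theta$ and $a_0\in\mathcal A$. 1. *Linear bandit, finite class:* $\mathcal A=\{\|a\|_2\le1\}$, $\Theta\subset\{\|\theta\|_2=1\}$ finite and non-empty, $\eta(\theta,a)=\langle\theta,a\rangle$, $c=1$: $$\mathbb E[\mathrm{reg}(T)]\le C\,T^{15/16}(\log|\Theta|)^{1/16}.$$ 2. *Linear bandit, sparse class:* $\mathcal A,\eta,c$ as in 1, $\Theta=\{\theta\in\mathbb R^d:\|\theta\|_0\le s,\ \|\theta\|_2=1\}$ with $d,s\ge1$ and $T\ge1$: $$\mathbb E[\mathrm{reg}(T)]\le C\,T^{15/16}s^{1/16}(\log(2dT))^{1/16}.$$ 3. *Deterministic logistic bandit:* $\mathcal A=\{\|a\|_2=1\}$, $\Theta\subset\mathcal A$ finite and non-empty, $\eta(\theta,a)=(1+e^{-\langle\theta,a\rangle})^{-1}$, $c=e(e+1)^{-2}$: $$\mathbb E[\mathrm{reg}(T)]\le C\,T^{15/16}(\log|\Theta|)^{1/16}.$$ -/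

import Mathlib

open MeasureTheory ProbabilityTheory
open scoped RealInnerProductSpace

namespace ViOlin

/-- Actions and model parameters are vectors of `ℝ^d` with the Euclidean norm. -/
abbrev Vec (d : ℕ) := EuclideanSpace ℝ (Fin d)

/-- The stochastic part `ξ = (u, v)` of an input. -/
abbrev Noise (d : ℕ) := Vec d × Vec d

/-- An input `x = ((a, a'), (u, v))` of the prediction task. -/
abbrev Input (d : ℕ) := (Vec d × Vec d) × Noise d

/-- Labels and predictions, vectors of `ℝ^4`. -/
abbrev Label := Fin 4 → ℝ

/-- A revealed data point `(x, y)`. -/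
abbrev Datum (d : ℕ) := Input d × Label

/-- The joint law of the i.i.d. noises `ξ_1, ξ_2, …` with `ξ_t = (u_t, v_t)`, where `u_t`, `v_t` are
independent standard Gaussian vectors. The coordinate `ω t` is `ξ_{t+1}`. -/
noncomputable def noiseLaw (d : ℕ) : Measure (ℕ → Noise d) :=
  Measure.infinitePi fun _ => (stdGaussian (Vec d)).prod (stdGaussian (Vec d))

/-! ### Rewards -/

/-- `η(θ, a) = ⟨θ, a⟩`. -/
noncomputable def linearReward {d : ℕ} (θ a : Vec d) : ℝ := ⟪θ, a⟫

/-- `η(θ, a) = (1 + exp (-⟨θ, a⟩))⁻¹`. -/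
noncomputable def logisticReward {d : ℕ} (θ a : Vec d) : ℝ := (1 + Real.exp (-⟪θ, a⟫))⁻¹

/-- The regularized reward `η(θ, a) - (c / 2) ‖a‖²`. -/
noncomputable def regularized {d : ℕ} (c : ℝ) (η : Vec d → Vec d → ℝ) (θ a : Vec d) : ℝ :=
  η θ a - c / 2 * ‖a‖ ^ 2

/-- The constant `e (e + 1)⁻²` of the logistic bandit. -/
noncomputable def logisticConst : ℝ := Real.exp 1 / (Real.exp 1 + 1) ^ 2

/-- The Hessian in the action of a reward, as an operator. -/
noncomputable def hessian {d : ℕ} (f : Vec d → ℝ) (a : Vec d) : Vec d →L[ℝ] Vec d :=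
  fderiv ℝ (gradient f) a

/-- `B`, `ζg`, `ζh` bound the reward, its gradient and (in spectral norm) its Hessian in the action,
uniformly over the model class, on the actions of norm at most `2`. -/
def BoundedDerivs {d : ℕ} (η : Vec d → Vec d → ℝ) (Θ : Set (Vec d)) (B ζg ζh : ℝ) : Prop :=
  ∀ θ ∈ Θ, ∀ a : Vec d, ‖a‖ ≤ 2 →
    |η θ a| ≤ B ∧ ‖gradient (η θ) a‖ ≤ ζg ∧ ‖hessian (η θ) a‖ ≤ ζh

/-! ### The prediction task -/

/-- `[η(θ, a), η(θ, a'), ⟨∇η(θ, a'), u⟩, ⟨∇²η(θ, a') u, v⟩]` for `x = ((a, a'), (u, v))`. -/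
noncomputable def predictLabel {d : ℕ} (η : Vec d → Vec d → ℝ) (θ : Vec d) (x : Input d) : Label :=
  ![η θ x.1.1, η θ x.1.2, ⟪gradient (η θ) x.1.2, x.2.1⟫, ⟪hessian (η θ) x.1.2 x.2.1, x.2.2⟫]

/-- The clipped square loss of the model `θ` at a data point. -/
noncomputable def loss {d : ℕ} (η : Vec d → Vec d → ℝ) (κ₁ κ₂ : ℝ) (z : Datum d) (θ : Vec d) : ℝ :=
  (predictLabel η θ z.1 0 - z.2 0) ^ 2 + (predictLabel η θ z.1 1 - z.2 1) ^ 2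
    + min (κ₁ ^ 2) ((predictLabel η θ z.1 2 - z.2 2) ^ 2)
    + min (κ₂ ^ 2) ((predictLabel η θ z.1 3 - z.2 3) ^ 2)

/-- The pairs `(a, a')` of actions of norm at most `2`. -/
def actionPairs (d : ℕ) : Set (Vec d × Vec d) := {p | ‖p.1‖ ≤ 2 ∧ ‖p.2‖ ≤ 2}

/-- The labels whose two reward coordinates lie in `[-B, B]`. -/
def labels (B : ℝ) : Set Label := {y | |y 0| ≤ B ∧ |y 1| ≤ B}

/-! ### Online learning with stochastic input components -/

/-- An online learner over `Θ`: it maps each finite history to a probability distribution on `Θ`. -/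
structure Learner (d : ℕ) (Θ : Set (Vec d)) where
  predict : ∀ t : ℕ, Kernel (Fin t → Datum d) (Vec d)
  prob : ∀ t h, IsProbabilityMeasure (predict t h)
  supp : ∀ t h, predict t h Θᶜ = 0

/-- A strategy of nature: before the noise of the current round is drawn it selects a point of `X`,
after that it selects a label in `Y`; both may depend on everything drawn so far. A learner maps the
past data deterministically to its distribution `p_t`, so `p_t` is a function of the past noises too
and strategies that react to `p_t` are covered. -/
structure Nature (d : ℕ) (X : Set (Vec d × Vec d)) (Y : Set Label) where
  point : ∀ t : ℕ, (Fin t → Noise d) → Vec d × Vec d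
  label : ∀ t : ℕ, (Fin (t + 1) → Noise d) → Label
  measurable_point : ∀ t, Measurable (point t)
  measurable_label : ∀ t, Measurable (label t)
  point_mem : ∀ t ξ, point t ξ ∈ X
  label_mem : ∀ t ξ, label t ξ ∈ Y

/-- The data point revealed in round `t + 1`. -/
def Nature.datum {d : ℕ} {X : Set (Vec d × Vec d)} {Y : Set Label} (N : Nature d X Y)
    (ω : ℕ → Noise d) (t : ℕ) : Datum d :=
  ((N.point t fun i => ω i, ω t), N.label t fun i => ω i)

/-- The expected online learning regret over `T` rounds (the parameter `θ_t` is drawn from `p_t`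
independently of the rest, so its expectation is the inner integral). -/
noncomputable def onlineRegret {d : ℕ} {Θ : Set (Vec d)} {X : Set (Vec d × Vec d)} {Y : Set Label}
    (R : Learner d Θ) (ℓ : Datum d → Vec d → ℝ) (N : Nature d X Y) (T : ℕ) : ℝ :=
  ∫ ω, (∑ t ∈ Finset.range T,
        ∫ θ, ℓ (N.datum ω t) θ ∂(R.predict t fun i : Fin t => N.datum ω i)
      - ⨅ θ : Θ, ∑ t ∈ Finset.range T, ℓ (N.datum ω t) θ) ∂(noiseLaw d)

/-- The sign of a Rademacher variable coded by a Boolean. -/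
def sign (b : Bool) : ℝ := if b then 1 else -1

/-- An `X`-valued tree together with a `Y`-valued tree: the node in round `t + 1` is chosen from the
first `t` signs. As in the online protocol, points may use the earlier noises and labels also the
noise of the current round. -/
structure Tree (d : ℕ) (X : Set (Vec d × Vec d)) (Y : Set Label) where
  point : ∀ t : ℕ, (Fin t → Bool) → (Fin t → Noise d) → Vec d × Vec d
  label : ∀ t : ℕ, (Fin t → Bool) → (Fin (t + 1) → Noise d) → Label
  measurable_point : ∀ t ε, Measurable (point t ε)
  measurable_label : ∀ t ε, Measurable (label t ε)
  point_mem : ∀ t ε ξ, point t ε ξ ∈ X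
  label_mem : ∀ t ε ξ, label t ε ξ ∈ Y

/-- The data point at the node in round `t + 1` along the path of signs `ε`. -/
def Tree.datum {d : ℕ} {X : Set (Vec d × Vec d)} {Y : Set Label} (τ : Tree d X Y)
    {T : ℕ} (ε : Fin T → Bool) (ω : ℕ → Noise d) (t : Fin T) : Datum d :=
  ((τ.point t (fun i => ε (Fin.castLE t.2.le i)) (fun i => ω i), ω t),
    τ.label t (fun i => ε (Fin.castLE t.2.le i)) fun i => ω i)

/-- `E_ξ E_ε sup_{θ ∈ Θ} ∑_{t ≤ T} ε_t ℓ(x_t, y_t; θ)` along a tree. -/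
noncomputable def treeComplexity {d : ℕ} {X : Set (Vec d × Vec d)} {Y : Set Label}
    (ℓ : Datum d → Vec d → ℝ) (Θ : Set (Vec d)) (T : ℕ) (τ : Tree d X Y) : ℝ :=
  ∫ ω, (∑ ε : Fin T → Bool, ⨆ θ : Θ, ∑ t : Fin T, sign (ε t) * ℓ (τ.datum ε ω t) θ) / 2 ^ T
    ∂(noiseLaw d)

/-- The (distribution dependent) sequential Rademacher complexity of `{ℓ(·; θ) : θ ∈ Θ}`. -/
noncomputable def seqRademacher {d : ℕ} (X : Set (Vec d × Vec d)) (Y : Set Label)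
    (ℓ : Datum d → Vec d → ℝ) (Θ : Set (Vec d)) (T : ℕ) : ℝ :=
  ⨆ τ : Tree d X Y, treeComplexity ℓ Θ T τ

/-- The performance required of the online learner at horizon `T`: against every strategy of nature
its expected regret is at most twice the sequential Rademacher complexity. -/
def OnlineGuarantee {d : ℕ} {Θ : Set (Vec d)} (X : Set (Vec d × Vec d)) (Y : Set Label)
    (ℓ : Datum d → Vec d → ℝ) (T : ℕ) (R : Learner d Θ) : Prop :=
  ∀ N : Nature d X Y, onlineRegret R ℓ N T ≤ 2 * seqRademacher X Y ℓ Θ T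

/-! ### The algorithm -/

/-- `act` selects, for each distribution `p` on `Θ`, a maximizer over all of `ℝ^d` of the expected
virtual reward `a ↦ E_{θ ∼ p} η(θ, a)`. -/
def IsArgmaxRule {d : ℕ} (η : Vec d → Vec d → ℝ) (Θ : Set (Vec d)) (act : Measure (Vec d) → Vec d) :
    Prop :=
  ∀ p : Measure (Vec d), IsProbabilityMeasure p → p Θᶜ = 0 →
    IsMaxOn (fun a => ∫ θ, η θ a ∂p) Set.univ (act p)

/-- Virtual ascent with the online learner `R`, on the reward `η`, for the ground truth `θs`: the
history after `t` rounds together with the action `a_t`, on the noises `ω`. -/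
noncomputable def run {d : ℕ} {Θ : Set (Vec d)} (η : Vec d → Vec d → ℝ) (R : Learner d Θ)
    (act : Measure (Vec d) → Vec d) (θs a₀ : Vec d) (ω : ℕ → Noise d) :
    (t : ℕ) → (Fin t → Datum d) × Vec d
  | 0 => (Fin.elim0, a₀)
  | t + 1 =>
    let H := (run η R act θs a₀ ω t).1
    let a' := (run η R act θs a₀ ω t).2
    let a := act (R.predict t H)
    let x : Input d := ((a, a'), ω t)
    (Fin.snoc (α := fun _ => Datum d) H (x, predictLabel η θs x), a)

/-- The global regret `∑_{t=1}^T (sup_{a ∈ A} η(θs, a) - η(θs, a_t))` for the reward `η` over the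
action set `A` of the algorithm run on the reward `ηalg`, as a random variable. -/
noncomputable def globalRegret {d : ℕ} {Θ : Set (Vec d)} (η ηalg : Vec d → Vec d → ℝ)
    (A : Set (Vec d)) (R : Learner d Θ) (act : Measure (Vec d) → Vec d) (θs a₀ : Vec d) (T : ℕ)
    (ω : ℕ → Noise d) : ℝ :=
  ∑ t ∈ Finset.Icc 1 T, (sSup (η θs '' A) - η θs (run ηalg R act θs a₀ ω t).2)

/-- Run with the learner `R` on `ηalg`, the algorithm has expected global regret at most `b` after
`T` rounds, for every ground truth in `Θ`, every initial action in `A` and every argmax rule. -/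
def HasExpectedRegret {d : ℕ} {Θ : Set (Vec d)} (η ηalg : Vec d → Vec d → ℝ) (A : Set (Vec d))
    (T : ℕ) (R : Learner d Θ) (b : ℝ) : Prop :=
  ∀ θs ∈ Θ, ∀ a₀ ∈ A, ∀ act : Measure (Vec d) → Vec d, IsArgmaxRule ηalg Θ act →
    Integrable (globalRegret η ηalg A R act θs a₀ T) (noiseLaw d) ∧
      ∫ ω, globalRegret η ηalg A R act θs a₀ T ω ∂(noiseLaw d) ≤ b

/-- The algorithm on `ηalg`, with clipping levels `κ₁ = 2 ζg` and `κ₂ = 640 √2 ζh`, has expected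
global regret at most `b` after `T` rounds with every online learner whose online regret is at most
twice the sequential Rademacher complexity of its loss class, and learners attaining the bound
exist. -/
def AlgorithmRegretBound {d : ℕ} (η ηalg : Vec d → Vec d → ℝ) (A Θ : Set (Vec d)) (B ζg ζh : ℝ)
    (T : ℕ) (b : ℝ) : Prop :=
  (∀ R : Learner d Θ,
      OnlineGuarantee (actionPairs d) (labels B) (loss ηalg (2 * ζg) (640 * √2 * ζh)) T R →
        HasExpectedRegret η ηalg A T R b) ∧
    ∃ R : Learner d Θ, HasExpectedRegret η ηalg A T R b

/-- The `s`-sparse unit vectors. -/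
def sparseModels (d s : ℕ) : Set (Vec d) := {θ | {i | θ i ≠ 0}.ncard ≤ s ∧ ‖θ‖ = 1}

end ViOlin

namespace ViOlin

/-! ### Ridge rewards -/

/-! Both bandits have rewards `f ⟨θ, a⟩` with `f` nondecreasing, and `c` equals `f' 1`. Since `f''`
stays below `c` by a margin `μ`, the regularized reward is strongly concave with maximizer `θ` for
unit `θ`. This survives averaging over `θ ∼ p`, so the maximizer of the averaged reward is unique,
has norm at most 2, and depends measurably on the history.

The regret of one round is controlled by the dispersion `V = E_p ‖θ - θs‖²`. Replacing `p` by the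
ground truth changes the objective by `O(E_p ‖θ - θs‖)`, and quadratic growth at the optimum turns
this into a bound on the regret (`sub_pow_eight_le`). The online loss in turn controls `V`: in its
third coordinate the Gaussian `u` tests the difference of the gradients. Its clipped second moment
is at least a dimension-free constant times the squared norm of that difference, which is at least
`α² ‖θ - θs‖²` because the slopes are at least `α` (`mul_integral_le_integral_loss`). The labels
come from `θs`, so the best model in hindsight has loss zero. Seen as a strategy of nature, the run
has an online regret that dominates the total dispersion (`mul_integral_dispersion_le`).

The online regret is bounded through a finite net of the loss class by `log n / r + r M² T / 2` plus
a discretization error. For a learner with the guarantee this is a maximal inequality for the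
sequential Rademacher complexity (`seqRademacher_le`). Exponential weights on the net satisfy the
same bound directly (`onlineRegret_expWeightLearner_le`), which gives the existence claim.

Finally, a per-round regret is at most `ε` or at most its eighth power over `ε ^ 7`, so the total is
`O(ε T + V_total / ε ^ 7)`. With `r = ε ^ 8` and `ε = (L / T) ^ (1 / 16)`, where `L` is `log |Θ|` or
`s log (2dT)`, both terms are `O(T ε) = O(T ^ (15 / 16) L ^ (1 / 16))`. Finite classes are their own
nets; sparse classes are covered by rounding coordinates. -/

/-- The reward `f ⟨θ, a⟩`. -/
noncomputable def ridge {d : ℕ} (f : ℝ → ℝ) (θ a : Vec d) : ℝ := f ⟪θ, a⟫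

/-- A nondecreasing profile `f` with derivatives `f₁`, `f₂` for which the regularized ridge reward
`f ⟨θ, a⟩ - (c / 2) ‖a‖²` is strongly concave with maximizer `θ` for every unit vector `θ`. -/
structure IsRidgeProfile (f f₁ f₂ : ℝ → ℝ) (c α μ : ℝ) : Prop where
  hasDerivAt : ∀ x, HasDerivAt f (f₁ x) x
  hasDerivAt_deriv : ∀ x, HasDerivAt f₁ (f₂ x) x
  continuous_second : Continuous f₂
  c_pos : 0 < c
  α_pos : 0 < α
  μ_pos : 0 < μ
  μ_le : μ ≤ c
  le_deriv : ∀ x, |x| ≤ 2 → α ≤ f₁ x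
  deriv_nonneg : ∀ x, 0 ≤ f₁ x
  -- The factor `3 / 2` is what keeps the maximizers of averaged rewards in the ball of radius 2.
  deriv_le : ∀ x, f₁ x ≤ 3 / 2 * c
  second_le : ∀ x, f₂ x ≤ c - μ
  deriv_one : f₁ 1 = c

namespace IsRidgeProfile

variable {f f₁ f₂ : ℝ → ℝ} {c α μ : ℝ} {d : ℕ}

lemma continuous (hf : IsRidgeProfile f f₁ f₂ c α μ) : Continuous f :=
  continuous_iff_continuousAt.2 fun x => (hf.hasDerivAt x).continuousAt

lemma continuous_deriv (hf : IsRidgeProfile f f₁ f₂ c α μ) : Continuous f₁ :=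
  continuous_iff_continuousAt.2 fun x => (hf.hasDerivAt_deriv x).continuousAt

lemma monotone (hf : IsRidgeProfile f f₁ f₂ c α μ) : Monotone f :=
  monotone_of_hasDerivAt_nonneg hf.hasDerivAt hf.deriv_nonneg

lemma abs_sub_le (hf : IsRidgeProfile f f₁ f₂ c α μ) (x y : ℝ) :
    |f x - f y| ≤ 3 / 2 * c * |x - y| := by
  have := Convex.norm_image_sub_le_of_norm_hasDerivWithin_le (f := f) (f' := f₁) (s := Set.univ)
    (C := 3 / 2 * c) (fun z _ => (hf.hasDerivAt z).hasDerivWithinAt)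
    (fun z _ => by
      rw [Real.norm_eq_abs, abs_of_nonneg (hf.deriv_nonneg z)]
      exact hf.deriv_le z) convex_univ (Set.mem_univ y) (Set.mem_univ x)
  simpa [Real.norm_eq_abs] using this

/-- Since `f₂ ≤ c - μ`, the derivative is antitone. Only `c - μ` of the curvature `c` of the penalty
is spent; the rest is the strong concavity used later. -/
lemma concaveOn_sub_sq (hf : IsRidgeProfile f f₁ f₂ c α μ) :
    ConcaveOn ℝ Set.univ fun x => f x - (c - μ) / 2 * x ^ 2 := by
  have h1 : ∀ x, HasDerivAt (fun x => f x - (c - μ) / 2 * x ^ 2) (f₁ x - (c - μ) * x) x := by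
    intro x
    refine ((hf.hasDerivAt x).sub (((hasDerivAt_id' x).pow 2).const_mul ((c - μ) / 2))).congr_deriv ?_
    simp; ring
  have h2 : ∀ x, HasDerivAt (fun x => f₁ x - (c - μ) * x) (f₂ x - (c - μ)) x := by
    intro x
    refine ((hf.hasDerivAt_deriv x).sub ((hasDerivAt_id' x).const_mul (c - μ))).congr_deriv ?_
    simp
  have hanti : Antitone fun x => f₁ x - (c - μ) * x :=
    antitone_of_hasDerivAt_nonpos h2 fun x => by
      have := hf.second_le x
      simp only [Pi.zero_apply]
      linarith
  apply AntitoneOn.concaveOn_of_deriv convex_univ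
  · exact (continuous_iff_continuousAt.2 fun x => (h1 x).continuousAt).continuousOn
  · exact fun x _ => (h1 x).differentiableAt.differentiableWithinAt
  · rw [show deriv (fun x => f x - (c - μ) / 2 * x ^ 2) = fun x => f₁ x - (c - μ) * x from
      funext fun x => (h1 x).deriv]
    exact hanti.antitoneOn _

lemma midpoint_le (hf : IsRidgeProfile f f₁ f₂ c α μ) (x y : ℝ) :
    (f x + f y) / 2 - (c - μ) / 8 * (x - y) ^ 2 ≤ f ((x + y) / 2) := by
  have := hf.concaveOn_sub_sq.2 (Set.mem_univ x) (Set.mem_univ y)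
    (by norm_num : (0 : ℝ) ≤ 1 / 2) (by norm_num : (0 : ℝ) ≤ 1 / 2) (by norm_num)
  simp only [smul_eq_mul] at this
  rw [show 1 / 2 * x + 1 / 2 * y = (x + y) / 2 by ring] at this
  nlinarith

/-- Quadratic growth of `f x - (c / 2) x ^ 2` below its maximum at `1`. -/
lemma sq_sub_one_le (hf : IsRidgeProfile f f₁ f₂ c α μ) (x : ℝ) :
    μ / 2 * (x - 1) ^ 2 ≤ (f 1 - c / 2) - (f x - c / 2 * x ^ 2) := by
  set g : ℝ → ℝ := fun x => f x - (c - μ) / 2 * x ^ 2 with hg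
  have h1 : HasDerivAt g μ 1 := by
    refine ((hf.hasDerivAt 1).sub
      (((hasDerivAt_id' (1 : ℝ)).pow 2).const_mul ((c - μ) / 2))).congr_deriv ?_
    simp [hf.deriv_one]
  -- A concave function lies below its tangent at `1`, here of slope `f₁ 1 - (c - μ) = μ`; the slope
  -- inequalities are one-sided, hence the cases.
  have key : g x ≤ g 1 + μ * (x - 1) := by
    rcases lt_trichotomy x 1 with h | h | h
    · have := hf.concaveOn_sub_sq.le_slope_of_hasDerivAt (Set.mem_univ x) (Set.mem_univ 1) h h1
      rw [slope_def_field, le_div_iff₀ (by linarith)] at this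
      change _ ≤ g 1 - g x at this
      linarith
    · subst h; simp
    · have := hf.concaveOn_sub_sq.slope_le_of_hasDerivAt (Set.mem_univ 1) (Set.mem_univ x) h h1
      rw [slope_def_field, div_le_iff₀ (by linarith)] at this
      change g x - g 1 ≤ _ at this
      linarith
  simp only [hg] at key
  nlinarith

lemma hasGradientAt (hf : IsRidgeProfile f f₁ f₂ c α μ) (θ a : Vec d) :
    HasGradientAt (regularized c (ridge f) θ) (f₁ ⟪θ, a⟫ • θ - c • a) a := by
  rw [hasGradientAt_iff_hasFDerivAt]
  have h1 : HasFDerivAt (fun a : Vec d => f ⟪θ, a⟫) (f₁ ⟪θ, a⟫ • innerSL ℝ θ) a :=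
    (hf.hasDerivAt _).comp_hasFDerivAt a (innerSL ℝ θ).hasFDerivAt
  have h2 : HasFDerivAt (fun a : Vec d => c / 2 * ‖a‖ ^ 2) ((c / 2) • (2 • innerSL ℝ a)) a :=
    (hasStrictFDerivAt_norm_sq a).hasFDerivAt.const_mul (c / 2)
  refine (h1.sub h2).congr_fderiv ?_
  ext v
  simp
  ring

lemma gradient_eq (hf : IsRidgeProfile f f₁ f₂ c α μ) (θ : Vec d) :
    gradient (regularized c (ridge f) θ) = fun a => f₁ ⟪θ, a⟫ • θ - c • a :=
  funext fun a => (hf.hasGradientAt θ a).gradient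

lemma hessian_apply (hf : IsRidgeProfile f f₁ f₂ c α μ) (θ a u : Vec d) :
    hessian (regularized c (ridge f) θ) a u = (f₂ ⟪θ, a⟫ * ⟪θ, u⟫) • θ - c • u := by
  have h1 : HasFDerivAt (fun a : Vec d => f₁ ⟪θ, a⟫) (f₂ ⟪θ, a⟫ • innerSL ℝ θ) a :=
    (hf.hasDerivAt_deriv _).comp_hasFDerivAt a (innerSL ℝ θ).hasFDerivAt
  have h2 : HasFDerivAt (fun a : Vec d => f₁ ⟪θ, a⟫ • θ - c • a) _ a :=
    (h1.smul_const θ).sub ((hasFDerivAt_id a).const_smul c)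
  rw [hessian, hf.gradient_eq, h2.fderiv]
  simp

lemma predictLabel_eq (hf : IsRidgeProfile f f₁ f₂ c α μ) (θ : Vec d) (x : Input d) :
    predictLabel (regularized c (ridge f)) θ x =
      ![f ⟪θ, x.1.1⟫ - c / 2 * ‖x.1.1‖ ^ 2, f ⟪θ, x.1.2⟫ - c / 2 * ‖x.1.2‖ ^ 2,
        f₁ ⟪θ, x.1.2⟫ * ⟪θ, x.2.1⟫ - c * ⟪x.1.2, x.2.1⟫,
        f₂ ⟪θ, x.1.2⟫ * ⟪θ, x.2.1⟫ * ⟪θ, x.2.2⟫ - c * ⟪x.2.1, x.2.2⟫] := by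
  simp [predictLabel, hf.gradient_eq, hf.hessian_apply, regularized, ridge, inner_sub_left,
    inner_smul_left]

lemma continuous_predictLabel (hf : IsRidgeProfile f f₁ f₂ c α μ) :
    Continuous fun q : Vec d × Input d => predictLabel (regularized c (ridge f)) q.1 q.2 := by
  simp_rw [hf.predictLabel_eq]
  have h0 := hf.continuous
  have h1 := hf.continuous_deriv
  have h2 := hf.continuous_second
  refine continuous_pi fun i => ?_
  fin_cases i <;> simp <;> fun_prop

lemma continuous_loss (hf : IsRidgeProfile f f₁ f₂ c α μ) (κ₁ κ₂ : ℝ) :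
    Continuous fun q : Datum d × Vec d => loss (regularized c (ridge f)) κ₁ κ₂ q.1 q.2 := by
  have h : ∀ i, Continuous fun q : Datum d × Vec d =>
      predictLabel (regularized c (ridge f)) q.2 q.1.1 i := fun i =>
    (continuous_apply i).comp (hf.continuous_predictLabel.comp
      (continuous_snd.prodMk (continuous_fst.comp continuous_fst)))
  unfold loss
  have h0 := h 0
  have h1 := h 1
  have h2 := h 2
  have h3 := h 3
  fun_prop

end IsRidgeProfile

/-! ### Bounds for the clipped loss -/

lemma loss_nonneg {d : ℕ} (η : Vec d → Vec d → ℝ) (κ₁ κ₂ : ℝ) (z : Datum d) (θ : Vec d) :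
    0 ≤ loss η κ₁ κ₂ z θ := by
  unfold loss
  positivity

lemma loss_le {d : ℕ} {η : Vec d → Vec d → ℝ} {Θ : Set (Vec d)} {B ζg ζh : ℝ}
    (hb : BoundedDerivs η Θ B ζg ζh) (κ₁ κ₂ : ℝ) {z : Datum d} (hz : z.1.1 ∈ actionPairs d)
    (hy : z.2 ∈ labels B) {θ : Vec d} (hθ : θ ∈ Θ) :
    loss η κ₁ κ₂ z θ ≤ 8 * B ^ 2 + κ₁ ^ 2 + κ₂ ^ 2 := by
  have h : ∀ p y : ℝ, |p| ≤ B → |y| ≤ B → (p - y) ^ 2 ≤ 4 * B ^ 2 := by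
    intro p y hp hy
    have := abs_le.1 hp
    have := abs_le.1 hy
    nlinarith
  have h0 : (predictLabel η θ z.1 0 - z.2 0) ^ 2 ≤ 4 * B ^ 2 := h _ _ (hb θ hθ _ hz.1).1 hy.1
  have h1 : (predictLabel η θ z.1 1 - z.2 1) ^ 2 ≤ 4 * B ^ 2 := h _ _ (hb θ hθ _ hz.2).1 hy.2
  have h2 := min_le_left (κ₁ ^ 2) ((predictLabel η θ z.1 2 - z.2 2) ^ 2)
  have h3 := min_le_left (κ₂ ^ 2) ((predictLabel η θ z.1 3 - z.2 3) ^ 2)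
  unfold loss
  linarith

lemma loss_predictLabel_self {d : ℕ} (η : Vec d → Vec d → ℝ) (κ₁ κ₂ : ℝ) (x : Input d)
    (θ : Vec d) : loss η κ₁ κ₂ (x, predictLabel η θ x) θ = 0 := by
  simp [loss, sq_nonneg]

/-- The third residual is the gradient difference tested against `u`, and the other terms are
nonnegative. This is the only coordinate from which the analysis extracts information. -/
lemma min_le_loss_predictLabel {d : ℕ} (η : Vec d → Vec d → ℝ) (κ₁ κ₂ : ℝ) (x : Input d)
    (θ θs : Vec d) :
    min (κ₁ ^ 2) (⟪gradient (η θ) x.1.2 - gradient (η θs) x.1.2, x.2.1⟫ ^ 2)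
      ≤ loss η κ₁ κ₂ (x, predictLabel η θs x) θ := by
  have h3 : 0 ≤ min (κ₂ ^ 2) ((predictLabel η θ x 3 - predictLabel η θs x 3) ^ 2) := by positivity
  have h2 : predictLabel η θ x 2 - predictLabel η θs x 2 =
      ⟪gradient (η θ) x.1.2 - gradient (η θs) x.1.2, x.2.1⟫ := by
    simp [predictLabel, inner_sub_left]
  simp only [loss]
  rw [h2]
  linarith [sq_nonneg (predictLabel η θ x 0 - predictLabel η θs x 0),
    sq_nonneg (predictLabel η θ x 1 - predictLabel η θs x 1)]

/-- Gradients of ridge rewards with slopes at least `α` separate unit vectors. -/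
lemma norm_smul_sub_smul_sq_ge {d : ℕ} {θ θ' : Vec d} (hθ : ‖θ‖ = 1) (hθ' : ‖θ'‖ = 1)
    {α r s : ℝ} (hα : 0 ≤ α) (hr : α ≤ r) (hs : α ≤ s) :
    α ^ 2 * ‖θ - θ'‖ ^ 2 ≤ ‖r • θ - s • θ'‖ ^ 2 := by
  have h1 : ‖θ - θ'‖ ^ 2 = 2 - 2 * ⟪θ, θ'⟫ := by
    rw [norm_sub_sq_real, hθ, hθ']; ring
  have h2 : ‖r • θ - s • θ'‖ ^ 2 = r ^ 2 + s ^ 2 - 2 * (r * s * ⟪θ, θ'⟫) := by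
    rw [norm_sub_sq_real, norm_smul, norm_smul, hθ, hθ', inner_smul_left, inner_smul_right]
    simp; ring
  have h3 : ⟪θ, θ'⟫ ≤ 1 := by simpa [hθ, hθ'] using real_inner_le_norm θ θ'
  -- For unit vectors `‖r • θ - s • θ'‖² = (r - s)² + r s ‖θ - θ'‖²`.
  have h4 : α ^ 2 ≤ r * s := by nlinarith
  rw [h1, h2]
  nlinarith [sq_nonneg (r - s), mul_nonneg (sub_nonneg.2 h4) (sub_nonneg.2 h3)]

/-! ### The linear and the logistic profile -/

lemma isRidgeProfile_id : IsRidgeProfile (fun x => x) (fun _ => 1) (fun _ => 0) 1 1 1 where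
  hasDerivAt := hasDerivAt_id'
  hasDerivAt_deriv x := hasDerivAt_const x 1
  continuous_second := continuous_const
  c_pos := one_pos
  α_pos := one_pos
  μ_pos := one_pos
  μ_le := le_rfl
  le_deriv _ _ := le_rfl
  deriv_nonneg _ := zero_le_one
  deriv_le _ := by norm_num
  second_le _ := by norm_num
  deriv_one := rfl

lemma one_sixth_le_logisticConst : 1 / 6 ≤ logisticConst := by
  have h1 := Real.exp_one_lt_three
  have h2 := Real.exp_one_gt_two
  rw [logisticConst, le_div_iff₀ (by positivity)]
  nlinarith

lemma isRidgeProfile_sigmoid :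
    IsRidgeProfile Real.sigmoid (fun x => Real.sigmoid x * (1 - Real.sigmoid x))
      (fun x => Real.sigmoid x * (1 - Real.sigmoid x) * (1 - 2 * Real.sigmoid x))
      logisticConst (1 / 20) (1 / 20) where
  hasDerivAt := Real.hasDerivAt_sigmoid
  hasDerivAt_deriv x := by
    refine ((Real.hasDerivAt_sigmoid x).mul
      ((Real.hasDerivAt_sigmoid x).const_sub 1)).congr_deriv ?_
    ring
  continuous_second := by
    have : Continuous Real.sigmoid :=
      continuous_iff_continuousAt.2 fun x => (Real.hasDerivAt_sigmoid x).continuousAt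
    fun_prop
  c_pos := by linarith [one_sixth_le_logisticConst]
  α_pos := by norm_num
  μ_pos := by norm_num
  μ_le := by linarith [one_sixth_le_logisticConst]
  le_deriv x hx := by
    have hx := abs_le.1 hx
    -- This puts `w = exp (-x)` in `[1/9, 9]`, where `w / (1 + w)²` is at least `9/100 > 1/20`.
    have h3 : Real.exp 2 ≤ 9 := by
      rw [show (2 : ℝ) = 1 + 1 by norm_num, Real.exp_add]
      nlinarith [Real.exp_one_lt_three, Real.exp_pos 1]
    have hu : Real.exp (-x) ≤ 9 := (Real.exp_le_exp.2 (by linarith)).trans h3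
    have hl : 1 / 9 ≤ Real.exp (-x) := by
      have h4 : Real.exp x ≤ 9 := (Real.exp_le_exp.2 hx.2).trans h3
      rw [Real.exp_neg, one_div]
      exact inv_anti₀ (Real.exp_pos x) h4
    have h5 : Real.sigmoid x * (1 - Real.sigmoid x) = Real.exp (-x) / (1 + Real.exp (-x)) ^ 2 := by
      have : 1 + Real.exp (-x) ≠ 0 := by positivity
      rw [Real.sigmoid_def]
      field_simp
      ring
    rw [h5, le_div_iff₀ (by positivity)]
    nlinarith
  deriv_nonneg x := mul_nonneg (Real.sigmoid_nonneg x) (by linarith [Real.sigmoid_le_one x])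
  deriv_le x := by nlinarith [sq_nonneg (Real.sigmoid x - 1 / 2), one_sixth_le_logisticConst]
  second_le x := by
    have h0 := Real.sigmoid_nonneg x
    have h1 := Real.sigmoid_le_one x
    set s := Real.sigmoid x
    -- With `w = (1 - 2s)²` the left side is `(1 - w)² w / 16 ≤ 1/100`. Then `1/10 ≤ 1/6 - 1/20 ≤ c
    -- - μ`.
    have h2 : (s * (1 - s) * (1 - 2 * s)) ^ 2 ≤ (1 / 10) ^ 2 := by
      have : ∀ w : ℝ, 0 ≤ w → w ≤ 1 → (1 - w) ^ 2 * w ≤ 4 / 25 := by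
        intro w hw hw1
        nlinarith [mul_nonneg hw (sq_nonneg (w - 1 / 3)), sq_nonneg (w - 1 / 3),
          mul_nonneg (sub_nonneg.2 hw1) (sq_nonneg (w - 1 / 3))]
      have := this ((1 - 2 * s) ^ 2) (sq_nonneg _) (by nlinarith)
      nlinarith
    have := (abs_le_of_sq_le_sq' h2 (by norm_num)).2
    linarith [one_sixth_le_logisticConst]
  deriv_one := by
    have : Real.exp 1 ≠ 0 := (Real.exp_pos 1).ne'
    have : Real.exp 1 + 1 ≠ 0 := by positivity
    rw [Real.sigmoid_def, logisticConst, Real.exp_neg]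
    field_simp
    ring

/-! ### Gaussian noise -/

/-- The truncated second moment of a standard Gaussian variable. -/
noncomputable def truncatedMoment : ℝ := ∫ x, min 1 (x ^ 2) ∂(gaussianReal 0 1)

lemma integrable_of_abs_le {Ω : Type*} [MeasurableSpace Ω] {P : Measure Ω} [IsFiniteMeasure P]
    {g : Ω → ℝ} {K : ℝ} (hg : AEStronglyMeasurable g P) (hb : ∀ x, |g x| ≤ K) : Integrable g P :=
  Integrable.of_bound hg K (.of_forall hb)

/-- The integrand vanishes only at `0`, and the Gaussian law has no atoms. -/
lemma truncatedMoment_pos : 0 < truncatedMoment := by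
  have hn : ∀ x : ℝ, 0 ≤ min 1 (x ^ 2) := fun x => by positivity
  refine lt_of_le_of_ne (integral_nonneg hn) fun h => ?_
  have hi : Integrable (fun x : ℝ => min 1 (x ^ 2)) (gaussianReal 0 1) :=
    integrable_of_abs_le (K := 1) (by fun_prop) fun x => by
      rw [abs_of_nonneg (hn x)]; exact min_le_left _ _
  have h0 := (integral_eq_zero_iff_of_nonneg hn hi).1 h.symm
  have := nullSingletonClass_gaussianReal (μ := 0) (v := 1) one_ne_zero
  have h1 : ∀ᵐ x ∂(gaussianReal 0 1), x ≠ 0 := by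
    simp [ae_iff, measure_singleton]
  obtain ⟨x, hx, hx0⟩ := (h0.and h1).exists
  rcases min_choice 1 (x ^ 2) with h2 | h2
  · simp [h2] at hx
  · simp [h2, hx0] at hx

lemma map_inner_stdGaussian {d : ℕ} (w : Vec d) :
    (stdGaussian (Vec d)).map (fun u => ⟪w, u⟫) = (gaussianReal 0 1).map (‖w‖ * ·) := by
  have h := IsGaussian.map_eq_gaussianReal (μ := stdGaussian (Vec d)) (innerSL ℝ w)
  rw [variance_dual_stdGaussian, integral_strongDual_stdGaussian, innerSL_apply_norm] at h
  rw [gaussianReal_map_const_mul, mul_zero, mul_one]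
  refine Eq.trans (by rfl) (h.trans ?_)
  congr 1
  exact Real.toNNReal_of_nonneg (sq_nonneg _)

/-- `⟪w, u⟫` is distributed as `‖w‖ x` with `x` standard normal, and `min (κ²) (‖w‖² x²) ≥ ‖w‖² min
1 (x²)` when `‖w‖ ≤ κ`. Clipping thus costs only a constant factor, independent of `d`. -/
lemma truncatedMoment_mul_le {d : ℕ} {w : Vec d} {κ : ℝ} (hw : ‖w‖ ≤ κ) :
    truncatedMoment * ‖w‖ ^ 2 ≤ ∫ u, min (κ ^ 2) (⟪w, u⟫ ^ 2) ∂(stdGaussian (Vec d)) := by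
  have h1 : ∫ u, min (κ ^ 2) (⟪w, u⟫ ^ 2) ∂(stdGaussian (Vec d)) =
      ∫ x, min (κ ^ 2) ((‖w‖ * x) ^ 2) ∂(gaussianReal 0 1) := by
    rw [← integral_map (φ := fun u : Vec d => ⟪w, u⟫) (f := fun x => min (κ ^ 2) (x ^ 2))
      (by fun_prop) (by fun_prop), map_inner_stdGaussian,
      integral_map (by fun_prop) (by fun_prop)]
  rw [h1, truncatedMoment, ← integral_mul_const]
  refine integral_mono ?_ ?_ fun x => ?_
  · refine (integrable_of_abs_le (K := 1) (by fun_prop) fun x => ?_).mul_const _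
    rw [abs_of_nonneg (by positivity)]; exact min_le_left _ _
  · refine integrable_of_abs_le (K := κ ^ 2) (by fun_prop) fun x => ?_
    rw [abs_of_nonneg (by positivity)]; exact min_le_left _ _
  · have h2 : ‖w‖ ^ 2 ≤ κ ^ 2 := pow_le_pow_left₀ (norm_nonneg w) hw 2
    refine le_min ?_ ?_
    · exact (mul_le_of_le_one_left (sq_nonneg _) (min_le_left _ _)).trans h2
    · rw [mul_pow, mul_comm]
      exact mul_le_mul_of_nonneg_left (min_le_right _ _) (sq_nonneg _)

lemma integrable_norm_stdGaussian (d : ℕ) :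
    Integrable (fun u : Vec d => ‖u‖) (stdGaussian (Vec d)) :=
  IsGaussian.integrable_id.norm

/-- A crude bound through `‖u‖ ≤ ∑ |u i| ≤ ∑ (1 + (u i)²) / 2`. It enters only the discretization
error, where the mesh of the net absorbs powers of `d`. -/
lemma integral_norm_stdGaussian_le (d : ℕ) : ∫ u : Vec d, ‖u‖ ∂(stdGaussian (Vec d)) ≤ d := by
  have hsq : ∀ i : Fin d, Integrable (fun u : Vec d => (u i) ^ 2) (stdGaussian (Vec d)) ∧
      ∫ u : Vec d, (u i) ^ 2 ∂(stdGaussian (Vec d)) = 1 := by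
    intro i
    have hm : (stdGaussian (Vec d)).map (fun u : Vec d => u i) = gaussianReal 0 1 := by
      have h := map_inner_stdGaussian (EuclideanSpace.single i (1 : ℝ) : Vec d)
      simpa [EuclideanSpace.inner_single_left] using h
    constructor
    · have : Integrable (fun x : ℝ => x ^ 2) ((stdGaussian (Vec d)).map (fun u : Vec d => u i)) := by
        rw [hm]; exact (memLp_id_gaussianReal 2).integrable_sq
      exact this.comp_measurable (by fun_prop)
    · rw [← integral_map (φ := fun u : Vec d => u i) (f := fun x => x ^ 2) (by fun_prop)
        (by fun_prop), hm]
      have := variance_id_gaussianReal (μ := 0) (v := 1)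
      rw [variance_of_integral_eq_zero (by fun_prop) (by simp)] at this
      simpa using this
  calc ∫ u : Vec d, ‖u‖ ∂(stdGaussian (Vec d))
      ≤ ∫ u : Vec d, ∑ i, (1 + (u i) ^ 2) / 2 ∂(stdGaussian (Vec d)) := by
        refine integral_mono (integrable_norm_stdGaussian d)
          (integrable_finsetSum _ fun i _ => (((integrable_const _).add (hsq i).1).div_const _))
          fun u => ?_
        have h1 : ‖u‖ ≤ ∑ i, |u i| := by
          rw [EuclideanSpace.norm_eq]
          refine Real.sqrt_le_iff.2 ⟨Finset.sum_nonneg fun i _ => abs_nonneg _, ?_⟩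
          simp only [Real.norm_eq_abs]
          exact Finset.sum_sq_le_sq_sum_of_nonneg fun i _ => abs_nonneg _
        refine h1.trans (Finset.sum_le_sum fun i _ => ?_)
        nlinarith [sq_nonneg (|u i| - 1), sq_abs (u i)]
    _ = d := by
        rw [integral_finsetSum]
        swap; · exact fun i _ => (((integrable_const _).add (hsq i).1).div_const _)
        have : ∀ i : Fin d, ∫ u : Vec d, (1 + (u i) ^ 2) / 2 ∂(stdGaussian (Vec d)) = 1 := by
          intro i
          rw [integral_div, integral_add (integrable_const _) (hsq i).1, (hsq i).2]
          norm_num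
        simp [this]

/-! ### Independence of the noises of different rounds -/

instance isProbabilityMeasure_noiseLaw (d : ℕ) : IsProbabilityMeasure (noiseLaw d) := by
  unfold noiseLaw; infer_instance

lemma measurePreserving_eval_noiseLaw (d t : ℕ) :
    MeasurePreserving (fun ω : ℕ → Noise d => ω t) (noiseLaw d)
      ((stdGaussian (Vec d)).prod (stdGaussian (Vec d))) :=
  measurePreserving_eval_infinitePi _ t

/-- The noise of a round is independent of the earlier noises. -/
lemma map_prefix_noiseLaw (d t : ℕ) :
    (noiseLaw d).map (fun ω => ((fun i : Fin t => ω i), ω t)) =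
      ((noiseLaw d).map fun ω => fun i : Fin t => ω i).prod
        ((stdGaussian (Vec d)).prod (stdGaussian (Vec d))) := by
  have h := iIndepFun_infinitePi (P := fun _ : ℕ => (stdGaussian (Vec d)).prod
    (stdGaussian (Vec d))) (X := fun _ x => x) fun _ => measurable_id
  have h1 := h.indepFun_finset (Finset.range t) {t} (by simp) fun i => by fun_prop
  have h2 : IndepFun (fun ω : ℕ → Noise d => fun i : Fin t => ω i) (fun ω => ω t) (noiseLaw d) := by
    have hψ : Measurable fun g : (({t} : Finset ℕ) → Noise d) =>
      g ⟨t, Finset.mem_singleton_self t⟩ := measurable_pi_apply _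
    have hφ : Measurable fun (g : (Finset.range t → Noise d)) (i : Fin t) =>
      g ⟨i, Finset.mem_range.2 i.2⟩ := by fun_prop
    exact h1.comp hφ hψ
  rw [(indepFun_iff_map_prod_eq_prod_map_map
    (Measurable.aemeasurable (by fun_prop)) (Measurable.aemeasurable (by fun_prop))).1 h2,
    (measurePreserving_eval_noiseLaw d t).map_eq]

/-- Conditioning on the past, written as Fubini: the current noise can be averaged first while
actions and history, which depend on the past, stay fixed. -/
lemma integral_noiseLaw_prefix {d t : ℕ} {G : (Fin t → Noise d) × Noise d → ℝ} (hG : Measurable G)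
    {K : ℝ} (hK : ∀ x, |G x| ≤ K) :
    ∫ ω, G (fun i => ω i, ω t) ∂(noiseLaw d) =
      ∫ ω, ∫ ζ, G (fun i : Fin t => ω i, ζ) ∂((stdGaussian (Vec d)).prod (stdGaussian (Vec d)))
        ∂(noiseLaw d) := by
  have hm : Measurable fun ω : ℕ → Noise d => fun i : Fin t => ω i := by fun_prop
  have := Measure.isProbabilityMeasure_map (μ := noiseLaw d) hm.aemeasurable
  rw [← integral_map (φ := fun ω : ℕ → Noise d => ((fun i : Fin t => ω i), ω t)) (f := G)
    (by fun_prop) hG.aestronglyMeasurable, map_prefix_noiseLaw,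
    integral_prod _ (integrable_of_abs_le hG.aestronglyMeasurable hK),
    integral_map hm.aemeasurable]
  exact hG.stronglyMeasurable.integral_prod_right'.aestronglyMeasurable

/-! ### Maximizers of the expected regularized reward -/

/-- A sequence of points, measurable in a parameter, that maximizes `F h` along `q`. -/
noncomputable def recursiveArgmax {H E : Type*} (F : H → E → ℝ) (q : ℕ → E) : ℕ → H → E
  | 0, _ => q 0
  | n + 1, h =>
    if F h (recursiveArgmax F q n h) ≤ F h (q (n + 1)) then q (n + 1) else recursiveArgmax F q n h

lemma le_recursiveArgmax {H E : Type*} (F : H → E → ℝ) (q : ℕ → E) (h : H) {k n : ℕ}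
    (hk : k ≤ n) : F h (q k) ≤ F h (recursiveArgmax F q n h) := by
  induction n with
  | zero => obtain rfl : k = 0 := by omega
            rfl
  | succ n ih =>
    rw [recursiveArgmax]
    rcases hk.lt_or_eq with hk | rfl
    · have := ih (by omega)
      split_ifs with h1
      · exact this.trans h1
      · exact this
    · split_ifs with h1
      · rfl
      · exact (not_le.1 h1).le

lemma measurable_recursiveArgmax {H E : Type*} [MeasurableSpace H] [MeasurableSpace E]
    {F : H → E → ℝ} (hF : ∀ a : H → E, Measurable a → Measurable fun h => F h (a h))
    (q : ℕ → E) (n : ℕ) : Measurable (recursiveArgmax F q n) := by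
  induction n with
  | zero => exact measurable_const
  | succ n ih =>
    exact Measurable.ite (measurableSet_le (hF _ ih) (hF _ measurable_const)) measurable_const ih

/-- Maximizers with quadratic growth depend measurably on parameters. -/
lemma measurable_argmax {H E : Type*} [MeasurableSpace H] [NormedAddCommGroup E]
    [MeasurableSpace E] [BorelSpace E] [SecondCountableTopology E] {F : H → E → ℝ} {A : H → E}
    (hF : ∀ a : H → E, Measurable a → Measurable fun h => F h (a h))
    (hc : ∀ h, Continuous (F h)) {m : ℝ} (hm : 0 < m)
    (hA : ∀ h b, m * ‖A h - b‖ ^ 2 ≤ F h (A h) - F h b) : Measurable A := by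
  -- The best among the first `n` points of a dense sequence is measurable in the parameter. Its
  -- value tends to the maximum, and quadratic growth then forces it to converge to the maximizer.
  refine measurable_of_tendsto_metrizable
    (f := fun n => recursiveArgmax F (TopologicalSpace.denseSeq E) n)
    (measurable_recursiveArgmax hF _) (tendsto_pi_nhds.2 fun h => ?_)
  rw [Metric.tendsto_atTop]
  intro ε hε
  have ho : IsOpen {a | F h (A h) - m * ε ^ 2 < F h a} := isOpen_lt continuous_const (hc h)
  obtain ⟨k, hk⟩ := (TopologicalSpace.denseRange_denseSeq E).exists_mem_open ho
    ⟨A h, by simp only [Set.mem_ofPred_eq]; nlinarith [mul_pos hm (pow_pos hε 2)]⟩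
  refine ⟨k, fun n hn => ?_⟩
  have h1 := le_recursiveArgmax F (TopologicalSpace.denseSeq E) h hn
  have h2 := hA h (recursiveArgmax F (TopologicalSpace.denseSeq E) n h)
  simp only [Set.mem_ofPred_eq] at hk
  rw [dist_comm, dist_eq_norm]
  have h3 : m * ‖A h - recursiveArgmax F (TopologicalSpace.denseSeq E) n h‖ ^ 2 < m * ε ^ 2 := by
    linarith
  exact lt_of_pow_lt_pow_left₀ 2 hε.le (lt_of_mul_lt_mul_left h3 hm.le)

namespace IsRidgeProfile

variable {f f₁ f₂ : ℝ → ℝ} {c α μ : ℝ} {d : ℕ}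

lemma abs_inner_sub_le (hf : IsRidgeProfile f f₁ f₂ c α μ) {θ : Vec d} (hθ : ‖θ‖ = 1)
    (a b : Vec d) : |f ⟪θ, a⟫ - f ⟪θ, b⟫| ≤ 3 / 2 * c * ‖a - b‖ := by
  refine (hf.abs_sub_le _ _).trans (mul_le_mul_of_nonneg_left ?_ (by linarith [hf.c_pos]))
  rw [← inner_sub_right]
  simpa [hθ] using abs_real_inner_le_norm θ (a - b)

lemma abs_inner_sub_le' (hf : IsRidgeProfile f f₁ f₂ c α μ) (θ θ' a : Vec d) :
    |f ⟪θ, a⟫ - f ⟪θ', a⟫| ≤ 3 / 2 * c * (‖a‖ * ‖θ - θ'‖) := by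
  refine (hf.abs_sub_le _ _).trans (mul_le_mul_of_nonneg_left ?_ (by linarith [hf.c_pos]))
  rw [← inner_sub_left, mul_comm]
  exact abs_real_inner_le_norm (θ - θ') a

variable {p : Measure (Vec d)}

lemma integrable_ridge [IsProbabilityMeasure p] (hf : IsRidgeProfile f f₁ f₂ c α μ)
    (hp : ∀ᵐ θ ∂p, ‖θ‖ = 1) (a : Vec d) : Integrable (fun θ : Vec d => f ⟪θ, a⟫) p := by
  have := hf.continuous
  refine Integrable.of_bound (Continuous.aestronglyMeasurable (by fun_prop))
    (|f 0| + 3 / 2 * c * ‖a‖) ?_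
  filter_upwards [hp] with θ hθ
  have h1 := hf.abs_inner_sub_le hθ a 0
  rw [inner_zero_right, sub_zero] at h1
  rw [Real.norm_eq_abs]
  have := abs_sub_abs_le_abs_sub (f ⟪θ, a⟫) (f 0)
  linarith

lemma integral_regularized [IsProbabilityMeasure p] (hf : IsRidgeProfile f f₁ f₂ c α μ)
    (hp : ∀ᵐ θ ∂p, ‖θ‖ = 1) (a : Vec d) :
    ∫ θ, regularized c (ridge f) θ a ∂p = (∫ θ, f ⟪θ, a⟫ ∂p) - c / 2 * ‖a‖ ^ 2 := by
  simp only [regularized, ridge]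
  rw [integral_sub (hf.integrable_ridge hp a) (integrable_const _)]
  simp

lemma abs_integral_ridge_sub_le [IsProbabilityMeasure p] (hf : IsRidgeProfile f f₁ f₂ c α μ)
    (hp : ∀ᵐ θ ∂p, ‖θ‖ = 1) (a b : Vec d) :
    |(∫ θ, f ⟪θ, a⟫ ∂p) - ∫ θ, f ⟪θ, b⟫ ∂p| ≤ 3 / 2 * c * ‖a - b‖ := by
  rw [← integral_sub (hf.integrable_ridge hp a) (hf.integrable_ridge hp b)]
  have := norm_integral_le_of_norm_le_const (μ := p)
    (f := fun θ : Vec d => f ⟪θ, a⟫ - f ⟪θ, b⟫) (C := 3 / 2 * c * ‖a - b‖)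
    (hp.mono fun θ hθ => hf.abs_inner_sub_le hθ a b)
  simpa using this

lemma continuous_integral_regularized [IsProbabilityMeasure p]
    (hf : IsRidgeProfile f f₁ f₂ c α μ) (hp : ∀ᵐ θ ∂p, ‖θ‖ = 1) :
    Continuous fun a => ∫ θ, regularized c (ridge f) θ a ∂p := by
  simp_rw [hf.integral_regularized hp]
  refine Continuous.sub ?_ (by fun_prop)
  have hc : 0 ≤ 3 / 2 * c := by linarith [hf.c_pos]
  refine (LipschitzWith.of_dist_le_mul (K := ⟨3 / 2 * c, hc⟩) fun a b => ?_).continuous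
  rw [Real.dist_eq, dist_eq_norm]
  exact hf.abs_integral_ridge_sub_le hp a b

/-- Strong concavity of the expected regularized reward at midpoints. -/
lemma midpoint_integral_regularized [IsProbabilityMeasure p]
    (hf : IsRidgeProfile f f₁ f₂ c α μ) (hp : ∀ᵐ θ ∂p, ‖θ‖ = 1) (a b : Vec d) :
    ((∫ θ, regularized c (ridge f) θ a ∂p) + ∫ θ, regularized c (ridge f) θ b ∂p) / 2
        + μ / 8 * ‖a - b‖ ^ 2 ≤
      ∫ θ, regularized c (ridge f) θ ((1 / 2 : ℝ) • (a + b)) ∂p := by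
  have hi : ∀ a, Integrable (fun θ => regularized c (ridge f) θ a) p := fun a =>
    (hf.integrable_ridge hp a).sub (integrable_const _)
  have hi' : Integrable (fun θ => (regularized c (ridge f) θ a + regularized c (ridge f) θ b) / 2) p :=
    ((hi a).add (hi b)).div_const 2
  have h1 : ∀ᵐ θ ∂p, μ / 8 * ‖a - b‖ ^ 2 ≤ regularized c (ridge f) θ ((1 / 2 : ℝ) • (a + b))
      - (regularized c (ridge f) θ a + regularized c (ridge f) θ b) / 2 := by
    filter_upwards [hp] with θ hθ
    have h2 := hf.midpoint_le ⟪θ, a⟫ ⟪θ, b⟫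
    have h3 : ⟪θ, (1 / 2 : ℝ) • (a + b)⟫ = (⟪θ, a⟫ + ⟪θ, b⟫) / 2 := by
      rw [inner_smul_right, inner_add_right]; ring
    have h4 : (⟪θ, a⟫ - ⟪θ, b⟫) ^ 2 ≤ ‖a - b‖ ^ 2 := by
      rw [← inner_sub_right, ← sq_abs]
      refine pow_le_pow_left₀ (abs_nonneg _) ?_ 2
      simpa [hθ] using abs_real_inner_le_norm θ (a - b)
    have h5 : ‖(1 / 2 : ℝ) • (a + b)‖ ^ 2 = (‖a‖ ^ 2 + ‖b‖ ^ 2) / 2 - ‖a - b‖ ^ 2 / 4 := by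
      have h6 := parallelogram_law_with_norm ℝ a b
      rw [norm_smul, mul_pow]
      norm_num
      nlinarith
    -- At the midpoint the penalty gains `c / 8 * ‖a - b‖²`, while `f` loses at most `(c - μ) / 8 *
    -- ‖a - b‖²`.
    have h7 : 0 ≤ c - μ := sub_nonneg.2 hf.μ_le
    simp only [regularized, ridge, h3, h5]
    nlinarith [mul_le_mul_of_nonneg_left h4 h7]
  have h2 := integral_mono_ae (integrable_const _) ((hi ((1 / 2 : ℝ) • (a + b))).sub hi') h1
  rw [integral_sub' (hi _) hi', integral_div, integral_add (hi a) (hi b)] at h2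
  simp only [integral_const, probReal_univ, one_smul] at h2
  linarith

/-- The midpoint of `a` and `b` cannot beat the maximizer `a`. -/
lemma growth_of_isMaxOn [IsProbabilityMeasure p] (hf : IsRidgeProfile f f₁ f₂ c α μ)
    (hp : ∀ᵐ θ ∂p, ‖θ‖ = 1) {a : Vec d}
    (ha : IsMaxOn (fun a => ∫ θ, regularized c (ridge f) θ a ∂p) Set.univ a) (b : Vec d) :
    μ / 4 * ‖a - b‖ ^ 2 ≤
      (∫ θ, regularized c (ridge f) θ a ∂p) - ∫ θ, regularized c (ridge f) θ b ∂p := by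
  have h1 := hf.midpoint_integral_regularized hp a b
  have h2 := isMaxOn_iff.1 ha ((1 / 2 : ℝ) • (a + b)) (Set.mem_univ _)
  linarith

/-- Moving from `a` to `a / 2` loses at most `3/4 c ‖a‖` of reward and saves `3/8 c ‖a‖²` of
penalty. The online guarantee and the derivative bounds cover only actions of norm at most 2. -/
lemma norm_le_two_of_isMaxOn [IsProbabilityMeasure p] (hf : IsRidgeProfile f f₁ f₂ c α μ)
    (hp : ∀ᵐ θ ∂p, ‖θ‖ = 1) {a : Vec d}
    (ha : IsMaxOn (fun a => ∫ θ, regularized c (ridge f) θ a ∂p) Set.univ a) : ‖a‖ ≤ 2 := by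
  have h1 := isMaxOn_iff.1 ha ((1 / 2 : ℝ) • a) (Set.mem_univ _)
  rw [hf.integral_regularized hp, hf.integral_regularized hp] at h1
  have h2 := (abs_le.1 (hf.abs_integral_ridge_sub_le hp a ((1 / 2 : ℝ) • a))).2
  have h3 : a - (1 / 2 : ℝ) • a = (1 / 2 : ℝ) • a := by
    nth_rewrite 1 [← one_smul ℝ a]
    rw [← sub_smul]; norm_num
  rw [h3] at h2
  have h4 : ‖(1 / 2 : ℝ) • a‖ = ‖a‖ / 2 := by rw [norm_smul]; norm_num; ring
  rw [h4] at h1 h2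
  have hc := hf.c_pos
  by_contra! h5
  have : c * (‖a‖ * (‖a‖ - 2)) > 0 := mul_pos hc (mul_pos (by linarith) (by linarith))
  nlinarith

/-- First and second moments of the distance of unit vectors to a unit vector. -/
lemma _root_.ViOlin.dist_moments [IsProbabilityMeasure p] (hp : ∀ᵐ θ ∂p, ‖θ‖ = 1) {θs : Vec d}
    (hθs : ‖θs‖ = 1) :
    Integrable (fun θ => ‖θ - θs‖) p ∧ Integrable (fun θ => ‖θ - θs‖ ^ 2) p ∧
      (∫ θ, ‖θ - θs‖ ∂p) ^ 2 ≤ ∫ θ, ‖θ - θs‖ ^ 2 ∂p ∧ ∫ θ, ‖θ - θs‖ ^ 2 ∂p ≤ 4 := by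
  have hbd : ∀ᵐ θ ∂p, ‖θ - θs‖ ≤ 2 := hp.mono fun θ hθ => by
    have := norm_sub_le θ θs
    rw [hθ, hθs] at this
    linarith
  have hi1 : Integrable (fun θ => ‖θ - θs‖) p :=
    Integrable.of_bound (Continuous.aestronglyMeasurable (by fun_prop)) 2
      (hbd.mono fun θ h => by simpa using h)
  have hi2 : Integrable (fun θ => ‖θ - θs‖ ^ 2) p :=
    Integrable.of_bound (Continuous.aestronglyMeasurable (by fun_prop)) 4
      (hbd.mono fun θ h => by
        rw [Real.norm_eq_abs, abs_of_nonneg (by positivity)]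
        nlinarith [norm_nonneg (θ - θs)])
  refine ⟨hi1, hi2, ?_, ?_⟩
  · set D := ∫ θ, ‖θ - θs‖ ∂p with hD
    have h : ∫ θ, (2 * D * ‖θ - θs‖ - D ^ 2) ∂p ≤ ∫ θ, ‖θ - θs‖ ^ 2 ∂p :=
      integral_mono ((hi1.const_mul _).sub (integrable_const _)) hi2 fun θ => by
        simp only
        nlinarith [sq_nonneg (‖θ - θs‖ - D)]
    rw [integral_sub (hi1.const_mul _) (integrable_const _), integral_const_mul] at h
    simp only [integral_const, probReal_univ, one_smul] at h
    nlinarith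
  · have := integral_mono_ae hi2 (integrable_const (4 : ℝ)) (hbd.mono fun θ h => by
      have := norm_nonneg (θ - θs)
      simp only
      nlinarith)
    simpa using this

/-- The excess of the maximizer is controlled by the dispersion of `p` around the ground truth. -/
lemma sub_pow_eight_le [IsProbabilityMeasure p] (hf : IsRidgeProfile f f₁ f₂ c α μ)
    (hp : ∀ᵐ θ ∂p, ‖θ‖ = 1) {a : Vec d}
    (ha : IsMaxOn (fun a => ∫ θ, regularized c (ridge f) θ a ∂p) Set.univ a) {θs : Vec d}
    (hθs : ‖θs‖ = 1) :
    (f 1 - f ⟪θs, a⟫) ^ 8 ≤ 4 * (81 / 4 * c ^ 3 / μ) ^ 4 * ∫ θ, ‖θ - θs‖ ^ 2 ∂p := by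
  have hc := hf.c_pos
  have hμ := hf.μ_pos
  obtain ⟨hi1, -, hDV, hV4⟩ := dist_moments hp hθs
  set D := ∫ θ, ‖θ - θs‖ ∂p with hD
  set V := ∫ θ, ‖θ - θs‖ ^ 2 ∂p with hV
  have hD0 : 0 ≤ D := integral_nonneg fun _ => norm_nonneg _
  -- The cost of replacing `p` by a point mass at the ground truth.
  have hclose : ∀ b : Vec d, |(∫ θ, f ⟪θ, b⟫ ∂p) - f ⟪θs, b⟫| ≤ 3 / 2 * c * (‖b‖ * D) := by
    intro b
    have h1 : (∫ θ, f ⟪θ, b⟫ ∂p) - f ⟪θs, b⟫ = ∫ θ, (f ⟪θ, b⟫ - f ⟪θs, b⟫) ∂p := by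
      rw [integral_sub (hf.integrable_ridge hp b) (integrable_const _)]; simp
    rw [h1, hD, ← integral_const_mul, ← integral_const_mul]
    refine (abs_integral_le_integral_abs).trans (integral_mono_ae ?_ ((hi1.const_mul _).const_mul _)
      (.of_forall fun θ => hf.abs_inner_sub_le' θ θs b))
    exact ((hf.integrable_ridge hp b).sub (integrable_const _)).abs
  have h1 := isMaxOn_iff.1 ha θs (Set.mem_univ _)
  rw [hf.integral_regularized hp, hf.integral_regularized hp, hθs] at h1
  have h2 := (abs_le.1 (hclose a)).2
  have h3 := (abs_le.1 (hclose θs)).1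
  rw [hθs, real_inner_self_eq_norm_sq, hθs, one_pow] at h3
  have h4 := hf.norm_le_two_of_isMaxOn hp ha
  have h5 := hf.sq_sub_one_le ⟪θs, a⟫
  set x := ⟪θs, a⟫
  have h6 : x ^ 2 ≤ ‖a‖ ^ 2 := by
    rw [← sq_abs]
    refine pow_le_pow_left₀ (abs_nonneg _) ?_ 2
    simpa [hθs] using abs_real_inner_le_norm θs a
  have h7 : 3 / 2 * c * (‖a‖ * D) ≤ 3 * c * D := by
    have := mul_le_mul_of_nonneg_right h4 hD0
    nlinarith
  -- The replacement costs `3 c D` at `a` and `3/2 c D` at `θs`; since `x² ≤ ‖a‖²`, the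
  -- one-dimensional growth at `1` applies.
  have h8 : μ / 2 * (x - 1) ^ 2 ≤ 9 / 2 * c * D := by nlinarith
  have h9 : (f 1 - f x) ^ 2 ≤ (3 / 2 * c) ^ 2 * (x - 1) ^ 2 := by
    have := pow_le_pow_left₀ (abs_nonneg _) (hf.abs_sub_le 1 x) 2
    rwa [sq_abs, mul_pow, sq_abs, ← sub_sq_comm x 1] at this
  have h10 : (x - 1) ^ 2 ≤ 9 * c * D / μ := by
    rw [le_div_iff₀ hμ]; linarith
  have h11 : (f 1 - f x) ^ 2 ≤ 81 / 4 * c ^ 3 / μ * D :=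
    h9.trans ((mul_le_mul_of_nonneg_left h10 (sq_nonneg _)).trans (le_of_eq (by ring)))
  -- One factor `D²` is bounded trivially by 4. The fourth power of the excess is already `O(V)`;
  -- the eighth is the form that leads to the exponent `15/16`.
  have h12 : D ^ 2 * D ^ 2 ≤ V * 4 :=
    mul_le_mul hDV (hDV.trans hV4) (sq_nonneg _) ((sq_nonneg _).trans hDV)
  have h13 := pow_le_pow_left₀ (sq_nonneg _) h11 4
  have h14 : 0 ≤ (81 / 4 * c ^ 3 / μ) ^ 4 := by positivity
  generalize 81 / 4 * c ^ 3 / μ = M at h13 h14 ⊢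
  calc (f 1 - f x) ^ 8 = ((f 1 - f x) ^ 2) ^ 4 := by ring
    _ ≤ (M * D) ^ 4 := h13
    _ = M ^ 4 * (D ^ 2 * D ^ 2) := by ring
    _ ≤ M ^ 4 * (V * 4) := mul_le_mul_of_nonneg_left h12 h14
    _ = 4 * M ^ 4 * V := by ring

variable {Θ : Set (Vec d)} {act : Measure (Vec d) → Vec d}

/-- The argmax rule is an arbitrary selection with no measurability assumed; quadratic growth makes
the maximizer unique and supplies it. -/
lemma measurable_act_comp {H : Type*} [MeasurableSpace H] (hf : IsRidgeProfile f f₁ f₂ c α μ)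
    (hΘ : ∀ θ ∈ Θ, ‖θ‖ = 1) (hact : IsArgmaxRule (regularized c (ridge f)) Θ act)
    (κ : Kernel H (Vec d)) (hκ : ∀ h, IsProbabilityMeasure (κ h)) (hs : ∀ h, κ h Θᶜ = 0) :
    Measurable fun h => act (κ h) := by
  have hp : ∀ h, ∀ᵐ θ ∂(κ h), ‖θ‖ = 1 := fun h =>
    (measure_eq_zero_iff_ae_notMem.1 (hs h)).mono fun θ hθ => hΘ θ (by simpa using hθ)
  have : IsMarkovKernel κ := ⟨hκ⟩
  have hη : Continuous fun q : Vec d × Vec d => regularized c (ridge f) q.1 q.2 := by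
    have := hf.continuous
    unfold regularized ridge
    fun_prop
  refine measurable_argmax (F := fun h a => ∫ θ, regularized c (ridge f) θ a ∂(κ h))
    (m := μ / 4) (fun a ha => ?_) (fun h => hf.continuous_integral_regularized (hp h))
    (by linarith [hf.μ_pos]) fun h b =>
      hf.growth_of_isMaxOn (hp h) (hact (κ h) (hκ h) (hs h)) b
  refine (StronglyMeasurable.integral_kernel_prod_right
    (f := fun h θ => regularized c (ridge f) θ (a h)) (κ := κ) ?_).measurable
  exact (hη.measurable.comp (measurable_snd.prodMk (ha.comp measurable_fst))).stronglyMeasurable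

end IsRidgeProfile

/-! ### The run of the algorithm as a strategy of nature -/

section Run

variable {d : ℕ} {Θ : Set (Vec d)} (η : Vec d → Vec d → ℝ) (R : Learner d Θ)
  (act : Measure (Vec d) → Vec d) (θs a₀ : Vec d)

/-- The data point of round `t + 1` of the algorithm. -/
noncomputable def runDatum (ω : ℕ → Noise d) (t : ℕ) : Datum d :=
  ((((run η R act θs a₀ ω (t + 1)).2, (run η R act θs a₀ ω t).2), ω t),
    predictLabel η θs (((run η R act θs a₀ ω (t + 1)).2, (run η R act θs a₀ ω t).2), ω t))

lemma run_succ_snd (ω : ℕ → Noise d) (t : ℕ) :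
    (run η R act θs a₀ ω (t + 1)).2 = act (R.predict t (run η R act θs a₀ ω t).1) := rfl

lemma run_succ_fst (ω : ℕ → Noise d) (t : ℕ) :
    (run η R act θs a₀ ω (t + 1)).1 =
      Fin.snoc (α := fun _ => Datum d) (run η R act θs a₀ ω t).1 (runDatum η R act θs a₀ ω t) :=
  rfl

lemma run_fst (ω : ℕ → Noise d) (t : ℕ) :
    (run η R act θs a₀ ω t).1 = fun i : Fin t => runDatum η R act θs a₀ ω i := by
  induction t with
  | zero => exact funext fun i => i.elim0
  | succ t ih =>
    rw [run_succ_fst, ih]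
    funext i
    refine Fin.lastCases ?_ (fun j => ?_) i <;> simp

lemma run_congr {ω ω' : ℕ → Noise d} {t : ℕ} (h : ∀ i < t, ω i = ω' i) :
    run η R act θs a₀ ω t = run η R act θs a₀ ω' t := by
  induction t with
  | zero => rfl
  | succ t ih =>
    have ih := ih fun i hi => h i (by omega)
    rw [run, run, ih, h t (by omega)]

variable {η R act θs a₀}

lemma measurable_run (hη : Measurable (predictLabel η θs))
    (hact : ∀ t, Measurable fun h => act (R.predict t h)) (t : ℕ) :
    Measurable fun ω : ℕ → Noise d => run η R act θs a₀ ω t := by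
  induction t with
  | zero => exact measurable_const
  | succ t ih =>
    have h2 : Measurable fun ω : ℕ → Noise d => (run η R act θs a₀ ω (t + 1)).2 :=
      (hact t).comp ih.fst
    have h1 : Measurable fun ω : ℕ → Noise d => (run η R act θs a₀ ω (t + 1)).1 := by
      have hx : Measurable fun ω : ℕ → Noise d =>
          (((run η R act θs a₀ ω (t + 1)).2, (run η R act θs a₀ ω t).2), ω t) :=
        (h2.prodMk ih.snd).prodMk (measurable_pi_apply t)
      simp_rw [run_succ_fst]
      refine measurable_pi_lambda _ fun i => ?_
      refine Fin.lastCases ?_ (fun j => ?_) i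
      · simpa [runDatum] using hx.prodMk (hη.comp hx)
      · simpa [Function.comp_def] using (measurable_pi_apply j).comp ih.fst
    exact h1.prodMk h2

/-- Extension of a finite sequence of noises by zero. -/
def extendNoise {t : ℕ} (ξ : Fin t → Noise d) (i : ℕ) : Noise d := if h : i < t then ξ ⟨i, h⟩ else 0

lemma measurable_extendNoise (t : ℕ) : Measurable (extendNoise : (Fin t → Noise d) → _) := by
  refine measurable_pi_lambda _ fun i => ?_
  unfold extendNoise
  split_ifs
  · exact measurable_pi_apply _
  · exact measurable_const

/-- Strategies of nature receive finite noise sequences, the run an infinite one. Padding is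
harmless because `t` rounds read only the first `t` noises. -/
lemma run_extendNoise (ω : ℕ → Noise d) (t : ℕ) :
    run η R act θs a₀ (extendNoise fun i : Fin t => ω i) t = run η R act θs a₀ ω t :=
  run_congr _ _ _ _ _ fun i hi => by simp [extendNoise, hi]

/-- An action is fixed before the noise of its round is drawn, so `t` noises already determine the
action with index `t + 1`. This makes the run an admissible strategy of nature. -/
lemma run_succ_snd_extendNoise (ω : ℕ → Noise d) (t : ℕ) :
    (run η R act θs a₀ (extendNoise fun i : Fin t => ω i) (t + 1)).2 =
      (run η R act θs a₀ ω (t + 1)).2 := by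
  rw [run_succ_snd, run_succ_snd, run_extendNoise]

lemma norm_run_snd_le (ha₀ : ‖a₀‖ ≤ 2) (hact : ∀ t h, ‖act (R.predict t h)‖ ≤ 2)
    (ω : ℕ → Noise d) (t : ℕ) : ‖(run η R act θs a₀ ω t).2‖ ≤ 2 := by
  cases t with
  | zero => exact ha₀
  | succ t => exact hact _ _

/-- The strategy of nature that plays the algorithm against the learner. -/
noncomputable def runNature {B : ℝ} (hη : Measurable (predictLabel η θs))
    (hB : ∀ a : Vec d, ‖a‖ ≤ 2 → |η θs a| ≤ B)
    (hact : ∀ t, Measurable fun h => act (R.predict t h))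
    (hact2 : ∀ t h, ‖act (R.predict t h)‖ ≤ 2) (ha₀ : ‖a₀‖ ≤ 2) :
    Nature d (actionPairs d) (labels B) where
  point t ξ := ((run η R act θs a₀ (extendNoise ξ) (t + 1)).2,
    (run η R act θs a₀ (extendNoise ξ) t).2)
  label t ξ := predictLabel η θs
    (((run η R act θs a₀ (extendNoise fun i : Fin t => ξ i.castSucc) (t + 1)).2,
      (run η R act θs a₀ (extendNoise fun i : Fin t => ξ i.castSucc) t).2), ξ (Fin.last t))
  measurable_point t :=
    (((measurable_run hη hact (t + 1)).comp (measurable_extendNoise t)).snd).prodMk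
      (((measurable_run hη hact t).comp (measurable_extendNoise t)).snd)
  measurable_label t := by
    have h : Measurable fun (ξ : Fin (t + 1) → Noise d) (i : Fin t) => ξ i.castSucc := by fun_prop
    exact hη.comp ((((((measurable_run hη hact (t + 1)).comp (measurable_extendNoise t)).comp
      h).snd).prodMk ((((measurable_run hη hact t).comp (measurable_extendNoise t)).comp
      h).snd)).prodMk (measurable_pi_apply _))
  point_mem t ξ := ⟨norm_run_snd_le ha₀ hact2 _ _, norm_run_snd_le ha₀ hact2 _ _⟩
  label_mem t ξ := ⟨hB _ (norm_run_snd_le ha₀ hact2 _ _), hB _ (norm_run_snd_le ha₀ hact2 _ _)⟩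

lemma runNature_datum {B : ℝ} (hη : Measurable (predictLabel η θs))
    (hB : ∀ a : Vec d, ‖a‖ ≤ 2 → |η θs a| ≤ B)
    (hact : ∀ t, Measurable fun h => act (R.predict t h))
    (hact2 : ∀ t h, ‖act (R.predict t h)‖ ≤ 2) (ha₀ : ‖a₀‖ ≤ 2) (ω : ℕ → Noise d) (t : ℕ) :
    (runNature hη hB hact hact2 ha₀).datum ω t = runDatum η R act θs a₀ ω t := by
  simp only [Nature.datum, runNature, runDatum, Fin.val_castSucc, Fin.val_last,
    run_succ_snd_extendNoise, run_extendNoise]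

end Run

/-! ### From online regret to dispersion, and from dispersion to global regret -/

section Analysis

variable {f f₁ f₂ : ℝ → ℝ} {c α μ : ℝ} {d : ℕ} {Θ : Set (Vec d)} {B ζg ζh : ℝ}

lemma Learner.ae_mem (R : Learner d Θ) (t : ℕ) (h : Fin t → Datum d) :
    ∀ᵐ θ ∂(R.predict t h), θ ∈ Θ :=
  (measure_eq_zero_iff_ae_notMem.1 (R.supp t h)).mono fun θ hθ => by simpa using hθ

lemma IsRidgeProfile.measurable_predictLabel (hf : IsRidgeProfile f f₁ f₂ c α μ) (θ : Vec d) :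
    Measurable (predictLabel (regularized c (ridge f)) θ) :=
  (hf.continuous_predictLabel.comp (Continuous.prodMk_right θ)).measurable

lemma IsRidgeProfile.continuous_loss_predictLabel (hf : IsRidgeProfile f f₁ f₂ c α μ)
    (κ₁ κ₂ : ℝ) (θs : Vec d) :
    Continuous fun q : Input d × Vec d => loss (regularized c (ridge f)) κ₁ κ₂
      (q.1, predictLabel (regularized c (ridge f)) θs q.1) q.2 := by
  have h1 : Continuous fun q : Input d × Vec d =>
      (((q.1, predictLabel (regularized c (ridge f)) θs q.1), q.2) : Datum d × Vec d) := by
    have h2 : Continuous fun q : Input d × Vec d => predictLabel (regularized c (ridge f)) θs q.1 :=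
      hf.continuous_predictLabel.comp (continuous_const.prodMk continuous_fst)
    exact (continuous_fst.prodMk h2).prodMk continuous_snd
  have h3 := (hf.continuous_loss (d := d) κ₁ κ₂).comp h1
  exact h3

/-- Averaged over the Gaussian directions, the loss of a model dominates its squared distance to
the ground truth. -/
lemma IsRidgeProfile.mul_integral_le_integral_loss (hf : IsRidgeProfile f f₁ f₂ c α μ)
    (hΘ : ∀ θ ∈ Θ, ‖θ‖ = 1) (hb : BoundedDerivs (regularized c (ridge f)) Θ B ζg ζh) (κ₂ : ℝ)
    {p : Measure (Vec d)} [IsProbabilityMeasure p] (hp : ∀ᵐ θ ∂p, θ ∈ Θ) {θs : Vec d}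
    (hθs : θs ∈ Θ) {x : Vec d × Vec d} (hx : x ∈ actionPairs d) :
    truncatedMoment * α ^ 2 * ∫ θ, ‖θ - θs‖ ^ 2 ∂p ≤
      ∫ ζ, ∫ θ, loss (regularized c (ridge f)) (2 * ζg) κ₂
        ((x, ζ), predictLabel (regularized c (ridge f)) θs (x, ζ)) θ ∂p
        ∂((stdGaussian (Vec d)).prod (stdGaussian (Vec d))) := by
  set ν := (stdGaussian (Vec d)).prod (stdGaussian (Vec d)) with hν
  have hcl : Continuous fun q : Noise d × Vec d =>
      loss (regularized c (ridge f)) (2 * ζg) κ₂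
        ((x, q.1), predictLabel (regularized c (ridge f)) θs (x, q.1)) q.2 :=
    (hf.continuous_loss_predictLabel (2 * ζg) κ₂ θs).comp
      (g := fun q : Input d × Vec d => loss (regularized c (ridge f)) (2 * ζg) κ₂
        (q.1, predictLabel (regularized c (ridge f)) θs q.1) q.2)
      (f := fun q : Noise d × Vec d => (((x, q.1), q.2) : Input d × Vec d)) (by fun_prop)
  -- The penalty does not depend on the model, so its gradient cancels.
  have hg0 : ∀ θ, gradient (regularized c (ridge f) θ) x.2 -
      gradient (regularized c (ridge f) θs) x.2 = f₁ ⟪θ, x.2⟫ • θ - f₁ ⟪θs, x.2⟫ • θs := by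
    intro θ
    rw [hf.gradient_eq, hf.gradient_eq, sub_sub_sub_cancel_right]
  generalize regularized c (ridge (d := d) f) = η at *
  set w : Vec d → Vec d := fun θ => f₁ ⟪θ, x.2⟫ • θ - f₁ ⟪θs, x.2⟫ • θs with hw
  have hcw : Continuous w := by
    have := hf.continuous_deriv
    fun_prop
  have hm : ∀ y, 0 ≤ min ((2 * ζg) ^ 2) (y ^ 2) := fun y => by positivity
  have hbd : ∀ᵐ q ∂(ν.prod p), ‖loss η (2 * ζg) κ₂ ((x, q.1), predictLabel η θs (x, q.1)) q.2‖ ≤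
      8 * B ^ 2 + (2 * ζg) ^ 2 + κ₂ ^ 2 := by
    have h1 : ∀ᵐ q ∂(ν.prod p), q.2 ∈ Θ := Measure.quasiMeasurePreserving_snd.ae hp
    filter_upwards [h1] with q hq
    rw [Real.norm_eq_abs, abs_of_nonneg (loss_nonneg _ _ _ _ _)]
    exact loss_le hb _ _ (z := ((x, q.1), predictLabel η θs (x, q.1))) hx
      ⟨(hb θs hθs _ hx.1).1, (hb θs hθs _ hx.2).1⟩ hq
  have hi1 : Integrable (Function.uncurry fun (ζ : Noise d) θ =>
      loss η (2 * ζg) κ₂ ((x, ζ), predictLabel η θs (x, ζ)) θ) (ν.prod p) :=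
    Integrable.of_bound hcl.aestronglyMeasurable _ hbd
  have hi2 : Integrable (Function.uncurry fun (ζ : Noise d) θ =>
      min ((2 * ζg) ^ 2) (⟪w θ, ζ.1⟫ ^ 2)) (ν.prod p) := by
    refine Integrable.of_bound (C := (2 * ζg) ^ 2)
      (Continuous.aestronglyMeasurable (by simp only [Function.uncurry_def]; fun_prop)) ?_
    refine .of_forall fun q => ?_
    rw [Real.norm_eq_abs, Function.uncurry_apply_pair, abs_of_nonneg (hm _)]
    exact min_le_left _ _
  calc truncatedMoment * α ^ 2 * ∫ θ, ‖θ - θs‖ ^ 2 ∂p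
      = ∫ θ, truncatedMoment * α ^ 2 * ‖θ - θs‖ ^ 2 ∂p := (integral_const_mul _ _).symm
    _ ≤ ∫ θ, ∫ ζ, min ((2 * ζg) ^ 2) (⟪w θ, ζ.1⟫ ^ 2) ∂ν ∂p := by
        refine integral_mono_ae ((dist_moments (hp.mono hΘ) (hΘ θs hθs)).2.1.const_mul _)
          hi2.integral_prod_right ?_
        filter_upwards [hp] with θ hθ
        -- The clipping level `κ₁ = 2 ζg` is exactly a bound for the difference of two gradients.
        have h1 : ‖w θ‖ ≤ 2 * ζg := by
          have := norm_sub_le (gradient (η θ) x.2) (gradient (η θs) x.2)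
          rw [hg0 θ] at this
          linarith [(hb θ hθ _ hx.2).2.1, (hb θs hθs _ hx.2).2.1]
        have h2 := truncatedMoment_mul_le h1
        have h3 : ∫ ζ, min ((2 * ζg) ^ 2) (⟪w θ, ζ.1⟫ ^ 2) ∂ν =
            ∫ u, min ((2 * ζg) ^ 2) (⟪w θ, u⟫ ^ 2) ∂(stdGaussian (Vec d)) := by
          rw [hν, integral_fun_fst fun u => min ((2 * ζg) ^ 2) (⟪w θ, u⟫ ^ 2)]
          simp
        have h4 : ∀ θ ∈ Θ, α ≤ f₁ ⟪θ, x.2⟫ := fun θ hθ => hf.le_deriv _ <| by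
          have := abs_real_inner_le_norm θ x.2
          rw [hΘ θ hθ, one_mul] at this
          exact this.trans hx.2
        have h5 := norm_smul_sub_smul_sq_ge (hΘ θ hθ) (hΘ θs hθs) hf.α_pos.le (h4 θ hθ) (h4 θs hθs)
        rw [h3]
        refine le_trans ?_ h2
        rw [mul_assoc]
        exact mul_le_mul_of_nonneg_left h5 truncatedMoment_pos.le
    _ = ∫ ζ, ∫ θ, min ((2 * ζg) ^ 2) (⟪w θ, ζ.1⟫ ^ 2) ∂p ∂ν := (integral_integral_swap hi2).symm
    _ ≤ _ := by
        refine integral_mono_ae hi2.integral_prod_left hi1.integral_prod_left ?_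
        filter_upwards [hi1.prod_right_ae, hi2.prod_right_ae] with ζ h1 h2
        refine integral_mono h2 h1 fun θ => ?_
        have := min_le_loss_predictLabel η (2 * ζg) κ₂ (x, ζ) θ θs
        rwa [hg0] at this

lemma Learner.measurable_integral_predict (R : Learner d Θ) {t : ℕ} {S : Type*} [MeasurableSpace S]
    {H : S → Fin t → Datum d} (hH : Measurable H) {g : S × Vec d → ℝ} (hg : Measurable g) :
    Measurable fun s => ∫ θ, g (s, θ) ∂(R.predict t (H s)) := by
  have : IsMarkovKernel (R.predict t) := ⟨R.prob t⟩
  exact (hg.stronglyMeasurable.integral_kernel_prod_right' (κ := (R.predict t).comap H hH)).measurable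

lemma IsRidgeProfile.measurable_act_predict (hf : IsRidgeProfile f f₁ f₂ c α μ)
    (hΘ : ∀ θ ∈ Θ, ‖θ‖ = 1) (R : Learner d Θ) {act : Measure (Vec d) → Vec d}
    (hact : IsArgmaxRule (regularized c (ridge f)) Θ act) (t : ℕ) :
    Measurable fun h => act (R.predict t h) :=
  hf.measurable_act_comp hΘ hact (R.predict t) (R.prob t) (R.supp t)

lemma IsRidgeProfile.norm_act_predict_le (hf : IsRidgeProfile f f₁ f₂ c α μ)
    (hΘ : ∀ θ ∈ Θ, ‖θ‖ = 1) (R : Learner d Θ) {act : Measure (Vec d) → Vec d}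
    (hact : IsArgmaxRule (regularized c (ridge f)) Θ act) (t : ℕ) (h : Fin t → Datum d) :
    ‖act (R.predict t h)‖ ≤ 2 := by
  have := R.prob t h
  exact hf.norm_le_two_of_isMaxOn ((R.ae_mem t h).mono hΘ) (hact _ this (R.supp t h))

/-- The expected squared distance to the ground truth of a parameter drawn in round `t + 1`. -/
noncomputable def dispersion (η : Vec d → Vec d → ℝ) (R : Learner d Θ)
    (act : Measure (Vec d) → Vec d) (θs a₀ : Vec d) (ω : ℕ → Noise d) (t : ℕ) : ℝ :=
  ∫ θ, ‖θ - θs‖ ^ 2 ∂(R.predict t (run η R act θs a₀ ω t).1)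

lemma integrable_dispersion {η : Vec d → Vec d → ℝ} {R : Learner d Θ}
    {act : Measure (Vec d) → Vec d} {θs a₀ : Vec d} (hη : Measurable (predictLabel η θs))
    (hact : ∀ t, Measurable fun h => act (R.predict t h)) (hΘ : ∀ θ ∈ Θ, ‖θ‖ = 1) (hθs : θs ∈ Θ)
    (t : ℕ) : Integrable (fun ω => dispersion η R act θs a₀ ω t) (noiseLaw d) := by
  refine integrable_of_abs_le (K := 4) ?_ fun ω => ?_
  · exact (R.measurable_integral_predict (measurable_run hη hact t).fst
      (g := fun q => ‖q.2 - θs‖ ^ 2) (by fun_prop)).aestronglyMeasurable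
  · have := R.prob t (run η R act θs a₀ ω t).1
    rw [dispersion, abs_of_nonneg (integral_nonneg fun _ => by positivity)]
    exact (dist_moments ((R.ae_mem t _).mono hΘ) (hΘ θs hθs)).2.2.2

/-- The online regret against the algorithm dominates the accumulated dispersion. -/
theorem IsRidgeProfile.mul_integral_dispersion_le (hf : IsRidgeProfile f f₁ f₂ c α μ)
    (hΘ : ∀ θ ∈ Θ, ‖θ‖ = 1) (hb : BoundedDerivs (regularized c (ridge f)) Θ B ζg ζh) (κ₂ : ℝ)
    (R : Learner d Θ) {act : Measure (Vec d) → Vec d}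
    (hact : IsArgmaxRule (regularized c (ridge f)) Θ act) {θs a₀ : Vec d} (hθs : θs ∈ Θ)
    (ha₀ : ‖a₀‖ ≤ 2) (T : ℕ) :
    truncatedMoment * α ^ 2 *
        ∫ ω, ∑ t ∈ Finset.range T, dispersion (regularized c (ridge f)) R act θs a₀ ω t ∂(noiseLaw d)
      ≤ onlineRegret R (loss (regularized c (ridge f)) (2 * ζg) κ₂)
        (runNature (a₀ := a₀) (hf.measurable_predictLabel θs) (fun a ha => (hb θs hθs a ha).1)
          (hf.measurable_act_predict hΘ R hact) (hf.norm_act_predict_le hΘ R hact) ha₀) T := by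
  have hη := hf.measurable_predictLabel θs
  have ham := hf.measurable_act_predict hΘ R hact
  have han := hf.norm_act_predict_le hΘ R hact
  have hcl : Measurable fun q : Input d × Vec d => loss (regularized c (ridge f)) (2 * ζg) κ₂
      (q.1, predictLabel (regularized c (ridge f)) θs q.1) q.2 :=
    (hf.continuous_loss_predictLabel (2 * ζg) κ₂ θs).measurable
  have hdisp := fun (p : Measure (Vec d)) (_ : IsProbabilityMeasure p) hp x hx =>
    hf.mul_integral_le_integral_loss hΘ hb κ₂ (p := p) hp hθs (x := x) hx
  unfold onlineRegret
  simp_rw [runNature_datum, ← run_fst]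
  generalize regularized c (ridge (d := d) f) = η at *
  set M := 8 * B ^ 2 + (2 * ζg) ^ 2 + κ₂ ^ 2 with hM
  -- The labels are generated by `θs`, whose loss vanishes.
  have hinf : ∀ ω, ⨅ θ : Θ, ∑ t ∈ Finset.range T,
      loss η (2 * ζg) κ₂ (runDatum η R act θs a₀ ω t) θ = 0 := by
    intro ω
    have h0 : ∀ θ : Θ, 0 ≤ ∑ t ∈ Finset.range T,
        loss η (2 * ζg) κ₂ (runDatum η R act θs a₀ ω t) θ := fun θ =>
      Finset.sum_nonneg fun t _ => loss_nonneg _ _ _ _ _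
    refine le_antisymm ((ciInf_le ⟨0, ?_⟩ ⟨θs, hθs⟩).trans_eq ?_) (Real.iInf_nonneg h0)
    · rintro _ ⟨θ, rfl⟩; exact h0 θ
    · exact Finset.sum_eq_zero fun t _ => loss_predictLabel_self _ _ _ _ _
  simp_rw [hinf, sub_zero]
  have key : ∀ t, Integrable (fun ω => ∫ θ, loss η (2 * ζg) κ₂ (runDatum η R act θs a₀ ω t) θ
        ∂(R.predict t (run η R act θs a₀ ω t).1)) (noiseLaw d) ∧
      truncatedMoment * α ^ 2 * ∫ ω, dispersion η R act θs a₀ ω t ∂(noiseLaw d) ≤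
        ∫ ω, ∫ θ, loss η (2 * ζg) κ₂ (runDatum η R act θs a₀ ω t) θ
          ∂(R.predict t (run η R act θs a₀ ω t).1) ∂(noiseLaw d) := by
    intro t
    set pt : (Fin t → Noise d) → Vec d × Vec d := fun ξ =>
      ((run η R act θs a₀ (extendNoise ξ) (t + 1)).2, (run η R act θs a₀ (extendNoise ξ) t).2)
    set hist : (Fin t → Noise d) → (Fin t → Datum d) := fun ξ =>
      (run η R act θs a₀ (extendNoise ξ) t).1
    have hptm : Measurable pt :=
      (((measurable_run hη ham (t + 1)).comp (measurable_extendNoise t)).snd).prodMk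
        (((measurable_run hη ham t).comp (measurable_extendNoise t)).snd)
    have hhm : Measurable hist := ((measurable_run hη ham t).comp (measurable_extendNoise t)).fst
    have hpt : ∀ ξ, pt ξ ∈ actionPairs d := fun ξ =>
      ⟨norm_run_snd_le ha₀ han _ _, norm_run_snd_le ha₀ han _ _⟩
    -- The expected loss of the round as a function of past and current noise, to which conditioning
    -- on the past applies.
    set G : (Fin t → Noise d) × Noise d → ℝ := fun q =>
      ∫ θ, loss η (2 * ζg) κ₂ ((pt q.1, q.2), predictLabel η θs (pt q.1, q.2)) θ
        ∂(R.predict t (hist q.1)) with hG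
    have hGm : Measurable G := by
      have hx : Measurable fun q : ((Fin t → Noise d) × Noise d) × Vec d =>
          (((pt q.1.1, q.1.2), q.2) : Input d × Vec d) := by fun_prop
      exact R.measurable_integral_predict (hhm.comp measurable_fst) (hcl.comp hx)
    have hGb : ∀ q, |G q| ≤ M := by
      intro q
      have := R.prob t (hist q.1)
      have h := norm_integral_le_of_norm_le_const (μ := R.predict t (hist q.1)) (C := M)
        (f := fun θ => loss η (2 * ζg) κ₂ ((pt q.1, q.2), predictLabel η θs (pt q.1, q.2)) θ)
        ((R.ae_mem t (hist q.1)).mono fun θ hθ => by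
          rw [Real.norm_eq_abs, abs_of_nonneg (loss_nonneg _ _ _ _ _)]
          exact loss_le hb _ _ (z := ((pt q.1, q.2), predictLabel η θs (pt q.1, q.2))) (hpt _)
            ⟨(hb θs hθs _ (hpt _).1).1, (hb θs hθs _ (hpt _).2).1⟩ hθ)
      simpa using h
    have hGω : ∀ ω : ℕ → Noise d, ∫ θ, loss η (2 * ζg) κ₂ (runDatum η R act θs a₀ ω t) θ
        ∂(R.predict t (run η R act θs a₀ ω t).1) = G (fun i => ω i, ω t) := by
      intro ω
      simp only [hG, pt, hist, run_extendNoise, run_succ_snd_extendNoise, runDatum]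
    have hpre : Measurable fun ω : ℕ → Noise d => ((fun i : Fin t => ω i), ω t) := by fun_prop
    simp_rw [hGω]
    refine ⟨integrable_of_abs_le (hGm.comp hpre).aestronglyMeasurable fun ω => hGb _, ?_⟩
    rw [integral_noiseLaw_prefix hGm hGb, ← integral_const_mul]
    refine integral_mono ((integrable_dispersion hη ham hΘ hθs t).const_mul _)
      (integrable_of_abs_le (K := M) ?_ fun ω => ?_) fun ω => ?_
    · exact (hGm.stronglyMeasurable.integral_prod_right'.measurable.comp
        (by fun_prop : Measurable fun ω : ℕ → Noise d => fun i : Fin t => ω i)).aestronglyMeasurable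
    · have h := norm_integral_le_of_norm_le_const
        (μ := (stdGaussian (Vec d)).prod (stdGaussian (Vec d))) (C := M)
        (f := fun ζ => G (fun i : Fin t => ω i, ζ)) (.of_forall fun ζ => hGb _)
      simpa using h
    · have := R.prob t (hist fun i => ω i)
      have h := hdisp (R.predict t (hist fun i => ω i)) this (R.ae_mem t _) _ (hpt fun i => ω i)
      refine le_trans (le_of_eq ?_) h
      simp only [dispersion, hist, run_extendNoise]
  rw [integral_finsetSum _ fun t _ => (key t).1,
    integral_finsetSum _ fun t _ => integrable_dispersion hη ham hΘ hθs t, Finset.mul_sum]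
  exact Finset.sum_le_sum fun t _ => (key t).2

lemma sum_Icc_one_eq_sum_range (g : ℕ → ℝ) (T : ℕ) :
    ∑ t ∈ Finset.Icc 1 T, g t = ∑ t ∈ Finset.range T, g (t + 1) := by
  induction T with
  | zero => simp
  | succ T ih => rw [Finset.sum_Icc_succ_top (by omega), ih, Finset.sum_range_succ]

lemma IsRidgeProfile.sSup_image_ridge (hf : IsRidgeProfile f f₁ f₂ c α μ) {A : Set (Vec d)}
    (hA : ∀ a ∈ A, ‖a‖ ≤ 1) {θs : Vec d} (hθs : ‖θs‖ = 1) (hmem : θs ∈ A) :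
    sSup (ridge f θs '' A) = f 1 := by
  refine IsGreatest.csSup_eq ⟨⟨θs, hmem, ?_⟩, ?_⟩
  · simp [ridge, hθs]
  · rintro _ ⟨a, ha, rfl⟩
    refine hf.monotone ((real_inner_le_norm _ _).trans ?_)
    rw [hθs, one_mul]
    exact hA a ha

/-- The global regret is integrable, and in expectation at most `λ T` plus a multiple of the
accumulated dispersion. -/
theorem IsRidgeProfile.integral_globalRegret_le (hf : IsRidgeProfile f f₁ f₂ c α μ)
    (hΘ : ∀ θ ∈ Θ, ‖θ‖ = 1) (R : Learner d Θ) {act : Measure (Vec d) → Vec d}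
    (hact : IsArgmaxRule (regularized c (ridge f)) Θ act) {θs a₀ : Vec d} (hθs : θs ∈ Θ)
    (ha₀ : ‖a₀‖ ≤ 2) {A : Set (Vec d)} (hA : ∀ a ∈ A, ‖a‖ ≤ 1) (hmem : θs ∈ A) (T : ℕ) :
    Integrable (globalRegret (ridge f) (regularized c (ridge f)) A R act θs a₀ T) (noiseLaw d) ∧
      ∀ ε : ℝ, 0 < ε →
        ∫ ω, globalRegret (ridge f) (regularized c (ridge f)) A R act θs a₀ T ω ∂(noiseLaw d) ≤
          ε * T + 4 * (81 / 4 * c ^ 3 / μ) ^ 4 / ε ^ 7 *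
            ∫ ω, ∑ t ∈ Finset.range T,
              dispersion (regularized c (ridge f)) R act θs a₀ ω t ∂(noiseLaw d) := by
  have hη := hf.measurable_predictLabel θs
  have ham := hf.measurable_act_predict hΘ R hact
  have han := hf.norm_act_predict_le hΘ R hact
  have hpt : ∀ t (h : Fin t → Datum d), (f 1 - f ⟪θs, act (R.predict t h)⟫) ^ 8 ≤
      4 * (81 / 4 * c ^ 3 / μ) ^ 4 * ∫ θ, ‖θ - θs‖ ^ 2 ∂(R.predict t h) := fun t h => by
    have := R.prob t h
    exact hf.sub_pow_eight_le ((R.ae_mem t h).mono hΘ) (hact _ this (R.supp t h)) (hΘ θs hθs)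
  have hK : 0 ≤ 4 * (81 / 4 * c ^ 3 / μ) ^ 4 := by positivity
  generalize 4 * (81 / 4 * c ^ 3 / μ) ^ 4 = K at hpt hK ⊢
  have hreg : ∀ ω, globalRegret (ridge f) (regularized c (ridge f)) A R act θs a₀ T ω =
      ∑ t ∈ Finset.range T, (f 1 - f ⟪θs, (run (regularized c (ridge f)) R act θs a₀ ω (t + 1)).2⟫) := by
    intro ω
    rw [globalRegret, hf.sSup_image_ridge hA (hΘ θs hθs) hmem, sum_Icc_one_eq_sum_range]
    rfl
  generalize regularized c (ridge (d := d) f) = η at *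
  have hi : ∀ t, Integrable (fun ω => f 1 - f ⟪θs, (run η R act θs a₀ ω (t + 1)).2⟫)
      (noiseLaw d) := by
    intro t
    refine integrable_of_abs_le (K := 3 / 2 * c * 3) ?_ fun ω => ?_
    · have h1 := (measurable_run (a₀ := a₀) hη ham (t + 1)).snd
      have h2 := hf.continuous.measurable
      exact (measurable_const.sub (h2.comp (measurable_const.inner h1))).aestronglyMeasurable
    · refine (hf.abs_sub_le _ _).trans
        (mul_le_mul_of_nonneg_left ?_ (by linarith [hf.c_pos]))
      have h1 := norm_run_snd_le (η := η) (θs := θs) ha₀ han ω (t + 1)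
      have h2 := abs_real_inner_le_norm θs (run η R act θs a₀ ω (t + 1)).2
      rw [hΘ θs hθs, one_mul] at h2
      have := abs_le.1 (h2.trans h1)
      rw [abs_le]
      constructor <;> linarith
  have hreg' : globalRegret (ridge f) η A R act θs a₀ T = _ := funext hreg
  rw [hreg']
  refine ⟨integrable_finsetSum _ fun t _ => hi t, fun ε hε => ?_⟩
  rw [integral_finsetSum _ fun t _ => hi t,
    integral_finsetSum _ fun t _ => integrable_dispersion hη ham hΘ hθs t, Finset.mul_sum]
  have hT : ε * T = ∑ t ∈ Finset.range T, ε := by simp [mul_comm]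
  rw [hT, ← Finset.sum_add_distrib]
  refine Finset.sum_le_sum fun t _ => ?_
  have hd := integrable_dispersion (a₀ := a₀) hη ham hΘ hθs t
  have h := integral_mono (hi t) ((integrable_const ε).add (hd.const_mul (K / ε ^ 7))) fun ω => by
    have h8 := hpt t (run η R act θs a₀ ω t).1
    rw [← run_succ_snd η R act θs a₀ ω t] at h8
    change _ ≤ K * dispersion η R act θs a₀ ω t at h8
    have hV : 0 ≤ dispersion η R act θs a₀ ω t := integral_nonneg fun _ => by positivity
    simp only [Pi.add_apply]
    generalize f 1 - f ⟪θs, (run η R act θs a₀ ω (t + 1)).2⟫ = r at h8 ⊢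
    generalize dispersion η R act θs a₀ ω t = V at h8 hV ⊢
    -- Either `r ≤ ε`, or `r ≤ r ^ 8 / ε ^ 7`.
    rcases le_total r ε with h | h
    · have : 0 ≤ K / ε ^ 7 * V := by positivity
      linarith
    · have h9 : ε ^ 7 ≤ r ^ 7 := pow_le_pow_left₀ hε.le h 7
      have h10 : r * ε ^ 7 ≤ K * V := by
        calc r * ε ^ 7 ≤ r * r ^ 7 := mul_le_mul_of_nonneg_left h9 (hε.le.trans h)
          _ = r ^ 8 := by ring
          _ ≤ K * V := h8
      have h11 : r ≤ K / ε ^ 7 * V := by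
        rw [div_mul_eq_mul_div, le_div_iff₀ (by positivity)]
        exact h10
      linarith
  refine h.trans (le_of_eq ?_)
  rw [integral_add' (integrable_const _) (hd.const_mul _), integral_const_mul]
  simp

end Analysis

/-! ### Sequential Rademacher complexity of finitely covered classes -/

/-- `N` is a finite subset of `Θ` whose losses approximate all losses of `Θ`, up to a multiple of
the size of the noise. -/
structure IsLossNet {d : ℕ} (ℓ : Datum d → Vec d → ℝ) (B : ℝ) (Θ : Set (Vec d))
    (N : Finset (Vec d)) (δ : ℝ) : Prop where
  subset : ∀ θ ∈ N, θ ∈ Θ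
  nonempty : N.Nonempty
  approx : ∀ θ ∈ Θ, ∃ θ' ∈ N, ∀ z : Datum d, z.1.1 ∈ actionPairs d → z.2 ∈ labels B →
    |ℓ z θ - ℓ z θ'| ≤ δ * (1 + ‖z.1.2.1‖)

lemma abs_sign (b : Bool) : |sign b| = 1 := by cases b <;> simp [sign]

/-- The exponential moments of a predictable sum of signs. -/
lemma sum_exp_signed_sum_le {M : ℝ} (r : ℝ) (Z : ∀ t : ℕ, (Fin t → Bool) → ℝ)
    (hZ : ∀ t ε, |Z t ε| ≤ M) (T : ℕ) :
    ∑ ε : Fin T → Bool,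
        Real.exp (r * ∑ t : Fin T, sign (ε t) * Z t fun i => ε (Fin.castLE t.2.le i)) ≤
      2 ^ T * Real.exp (r ^ 2 * M ^ 2 * T / 2) := by
  induction T with
  | zero => simp
  | succ T ih =>
    have hsplit : ∀ (b : Bool) (ε : Fin T → Bool),
        ∑ t : Fin (T + 1), sign (Fin.snoc (α := fun _ => Bool) ε b t) *
          Z t (fun i => Fin.snoc (α := fun _ => Bool) ε b (Fin.castLE t.2.le i)) =
        (∑ t : Fin T, sign (ε t) * Z t fun i => ε (Fin.castLE t.2.le i)) + sign b * Z T ε := by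
      intro b ε
      rw [Fin.sum_univ_castSucc]
      have h : ∀ (n : ℕ) (hn : n ≤ T) (i : Fin n), Fin.snoc (α := fun _ => Bool) ε b
          (Fin.castLE (hn.trans T.le_succ) i) = ε (Fin.castLE hn i) := fun n hn i =>
        Fin.snoc_castSucc (α := fun _ => Bool) b ε (Fin.castLE hn i)
      congr 1
      · refine Finset.sum_congr rfl fun t _ => ?_
        rw [Fin.snoc_castSucc]
        congr 2
        exact funext fun i => h t t.2.le i
      · rw [Fin.snoc_last]
        congr 2
        exact funext fun i => h T le_rfl i
    rw [← (Fin.snocEquiv fun _ => Bool).sum_comp, Fintype.sum_prod_type_right]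
    simp only [Fin.snocEquiv, Equiv.coe_fn_mk, hsplit]
    -- The coefficient of the last sign depends only on the earlier signs, so that sign averages to
    -- a `cosh`, which is at most `exp` of half the square.
    have hstep : ∀ ε : Fin T → Bool,
        ∑ b : Bool, Real.exp (r * ((∑ t : Fin T, sign (ε t) * Z t fun i => ε (Fin.castLE t.2.le i))
          + sign b * Z T ε)) ≤
        Real.exp (r * ∑ t : Fin T, sign (ε t) * Z t fun i => ε (Fin.castLE t.2.le i)) *
          (2 * Real.exp (r ^ 2 * M ^ 2 / 2)) := by
      intro ε
      simp_rw [mul_add, Real.exp_add]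
      rw [← Finset.mul_sum]
      refine mul_le_mul_of_nonneg_left ?_ (Real.exp_pos _).le
      have h1 := Real.cosh_le_exp_half_sq (r * Z T ε)
      have h2 : (r * Z T ε) ^ 2 / 2 ≤ r ^ 2 * M ^ 2 / 2 := by
        rw [mul_pow]
        have := sq_le_sq' (abs_le.1 (hZ T ε)).1 (abs_le.1 (hZ T ε)).2
        have := mul_le_mul_of_nonneg_left this (sq_nonneg r)
        linarith
      have h3 := h1.trans (Real.exp_le_exp.2 h2)
      rw [Real.cosh_eq] at h3
      simp only [Fintype.sum_bool, sign, if_true, Bool.false_eq_true, if_false, one_mul,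
        neg_one_mul, mul_neg]
      linarith
    refine (Finset.sum_le_sum fun ε _ => hstep ε).trans ?_
    rw [← Finset.sum_mul]
    refine (mul_le_mul_of_nonneg_right ih (by positivity)).trans (le_of_eq ?_)
    rw [show r ^ 2 * M ^ 2 * ((T + 1 : ℕ) : ℝ) / 2 = r ^ 2 * M ^ 2 * T / 2 + r ^ 2 * M ^ 2 / 2 by
      push_cast; ring, Real.exp_add]
    ring

/-- A maximal inequality for predictable sums of signs over a finite index set. -/
lemma exists_signed_sum_bound {ι : Type*} (N : Finset ι) (hN : N.Nonempty) {M r : ℝ} (hr : 0 < r)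
    (Z : ι → ∀ t : ℕ, (Fin t → Bool) → ℝ) (hZ : ∀ j ∈ N, ∀ t ε, |Z j t ε| ≤ M) (T : ℕ) :
    ∃ U : (Fin T → Bool) → ℝ,
      (∀ ε, ∀ j ∈ N,
        ∑ t : Fin T, sign (ε t) * Z j t (fun i => ε (Fin.castLE t.2.le i)) ≤ U ε) ∧
      (∑ ε, U ε) / 2 ^ T ≤ Real.log N.card / r + r * M ^ 2 * T / 2 := by
  set A : ℝ := N.card * Real.exp (r ^ 2 * M ^ 2 * T / 2) with hA
  have hcard : (0 : ℝ) < N.card := by exact_mod_cast hN.card_pos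
  have hA0 : 0 < A := by positivity
  set S : ι → (Fin T → Bool) → ℝ := fun j ε =>
    ∑ t : Fin T, sign (ε t) * Z j t (fun i => ε (Fin.castLE t.2.le i)) with hS
  -- The tangent of the logarithm at `A` replaces `log ∑ exp`. The bound is then linear in the
  -- exponential moments and can be averaged without Jensen's inequality; `A` is the bound for the
  -- mean of their sum.
  refine ⟨fun ε => (Real.log A - 1 + (∑ j ∈ N, Real.exp (r * S j ε)) / A) / r, fun ε j hj => ?_, ?_⟩
  · rw [le_div_iff₀ hr]
    change S j ε * r ≤ _
    have h1 := Real.add_one_le_exp (r * S j ε - Real.log A)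
    rw [Real.exp_sub, Real.exp_log hA0] at h1
    have h2 : Real.exp (r * S j ε) / A ≤ (∑ j ∈ N, Real.exp (r * S j ε)) / A :=
      div_le_div_of_nonneg_right
        (Finset.single_le_sum (f := fun j => Real.exp (r * S j ε)) (fun _ _ => (Real.exp_pos _).le) hj)
        hA0.le
    linarith
  · have h1 : ∑ ε, ∑ j ∈ N, Real.exp (r * S j ε) ≤ 2 ^ T * A := by
      rw [Finset.sum_comm]
      refine (Finset.sum_le_sum fun j hj => sum_exp_signed_sum_le r (Z j) (hZ j hj) T).trans ?_
      rw [Finset.sum_const, nsmul_eq_mul, hA]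
      exact le_of_eq (by ring)
    have h2 : Real.log A = Real.log N.card + r ^ 2 * M ^ 2 * T / 2 := by
      rw [hA, Real.log_mul hcard.ne' (Real.exp_pos _).ne', Real.log_exp]
    rw [← Finset.sum_div, Finset.sum_add_distrib, ← Finset.sum_div, Finset.sum_const,
      Finset.card_univ, Fintype.card_fun, Fintype.card_bool, Fintype.card_fin, nsmul_eq_mul]
    push_cast
    have h3 : (∑ ε, ∑ j ∈ N, Real.exp (r * S j ε)) / A ≤ 2 ^ T := by
      rwa [div_le_iff₀ hA0]
    rw [div_div, div_le_iff₀ (by positivity)]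
    calc (2 : ℝ) ^ T * (Real.log A - 1) + (∑ ε, ∑ j ∈ N, Real.exp (r * S j ε)) / A
        ≤ 2 ^ T * (Real.log A - 1) + 2 ^ T := by linarith
      _ = 2 ^ T * Real.log A := by ring
      _ = _ := by rw [h2]; field_simp

/-- A non-integrable function has Bochner integral `0`. Hence suprema and infima over `Θ` can be
bounded without proving them measurable. -/
lemma integral_le_of_le_nonneg {Ω : Type*} [MeasurableSpace Ω] {P : Measure Ω} {g h : Ω → ℝ}
    (hh : Integrable h P) (h0 : 0 ≤ ∫ x, h x ∂P) (hgh : ∀ x, g x ≤ h x) :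
    ∫ x, g x ∂P ≤ ∫ x, h x ∂P := by
  by_cases hg : Integrable g P
  · exact integral_mono hg hh hgh
  · rwa [integral_undef hg]

/-- The bound for losses in `[0, M]` with a net of `n` models at learning rate `r`. -/
noncomputable def netBound (d : ℕ) (n M r δ : ℝ) (T : ℕ) : ℝ :=
  Real.log n / r + r * M ^ 2 * T / 2 + δ * (T * (1 + d))

lemma integral_le_netBound {d T : ℕ} {n M r δ : ℝ} (hn : 1 ≤ n) (hr : 0 < r) (hδ : 0 ≤ δ)
    {g : (ℕ → Noise d) → ℝ}
    (hg : ∀ ω, g ω ≤ Real.log n / r + r * M ^ 2 * T / 2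
      + δ * ∑ t ∈ Finset.range T, (1 + ‖(ω t).1‖)) :
    ∫ ω, g ω ∂(noiseLaw d) ≤ netBound d n M r δ T := by
  have hit : ∀ t, Integrable (fun ω : ℕ → Noise d => ‖(ω t).1‖) (noiseLaw d) ∧
      ∫ ω : ℕ → Noise d, ‖(ω t).1‖ ∂(noiseLaw d) ≤ d := by
    intro t
    have h1 : Integrable (fun ζ : Noise d => ‖ζ.1‖)
        ((stdGaussian (Vec d)).prod (stdGaussian (Vec d))) :=
      (integrable_norm_stdGaussian d).comp_fst _
    refine ⟨(measurePreserving_eval_noiseLaw d t).integrable_comp_of_integrable h1, ?_⟩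
    rw [← integral_map (φ := fun ω : ℕ → Noise d => ω t) (f := fun ζ => ‖ζ.1‖)
      (measurable_pi_apply t).aemeasurable (by fun_prop), (measurePreserving_eval_noiseLaw d t).map_eq,
      integral_fun_fst (fun u : Vec d => ‖u‖)]
    simpa using integral_norm_stdGaussian_le d
  have hi2 : ∀ t ∈ Finset.range T,
      Integrable (fun ω : ℕ → Noise d => 1 + ‖(ω t).1‖) (noiseLaw d) := fun t _ =>
    (integrable_const _).add (hit t).1
  have hi3 := (integrable_finsetSum _ hi2).const_mul δ
  have hlog := Real.log_nonneg hn
  refine (integral_le_of_le_nonneg ((integrable_const _).add hi3)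
    (integral_nonneg fun ω => ?_) hg).trans ?_
  · simp only [Pi.add_apply, Pi.zero_apply]
    positivity
  · rw [integral_add' (integrable_const _) hi3, integral_const_mul, integral_finsetSum _ hi2]
    have h2 : ∑ t ∈ Finset.range T, ∫ ω : ℕ → Noise d, (1 + ‖(ω t).1‖) ∂(noiseLaw d) ≤
        ∑ t ∈ Finset.range T, ((1 : ℝ) + d) := by
      refine Finset.sum_le_sum fun t _ => ?_
      rw [integral_add (integrable_const _) (hit t).1]
      simpa using (hit t).2
    have h3 := mul_le_mul_of_nonneg_left h2 hδ
    simp only [Finset.sum_const, Finset.card_range, nsmul_eq_mul] at h3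
    simp only [integral_const, probReal_univ, one_smul, netBound]
    linarith

/-- The complexity of a tree is controlled by a finite net of the loss class. -/
theorem seqRademacher_le {d : ℕ} {ℓ : Datum d → Vec d → ℝ} {B M : ℝ} {Θ : Set (Vec d)}
    {N : Finset (Vec d)} {δ : ℝ} (hN : IsLossNet ℓ B Θ N δ) (hδ : 0 ≤ δ)
    (h0 : ∀ z θ, 0 ≤ ℓ z θ)
    (hM : ∀ z : Datum d, z.1.1 ∈ actionPairs d → z.2 ∈ labels B → ∀ θ ∈ Θ, ℓ z θ ≤ M)
    {r : ℝ} (hr : 0 < r) (T : ℕ) :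
    seqRademacher (actionPairs d) (labels B) ℓ Θ T ≤ netBound d N.card M r δ T := by
  have hn : (1 : ℝ) ≤ N.card := by exact_mod_cast hN.nonempty.card_pos
  have hlog := Real.log_nonneg hn
  -- Nonnegativity of the bound also covers the case that there are no trees.
  refine Real.iSup_le (fun τ => ?_) (by unfold netBound; positivity)
  refine integral_le_netBound hn hr hδ fun ω => ?_
  -- For frozen noise the losses along the tree are predictable functions of the signs.
  obtain ⟨U, hU, hUb⟩ := exists_signed_sum_bound N hN.nonempty hr
    (fun θ t ε => ℓ ((τ.point t ε (fun i => ω i), ω t), τ.label t ε fun i => ω i) θ)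
    (M := M) (fun θ hθ t ε => by
      rw [abs_of_nonneg (h0 _ _)]
      exact hM ((τ.point t ε (fun i => ω i), ω t), τ.label t ε fun i => ω i)
        (τ.point_mem _ _ _) (τ.label_mem _ _ _) θ (hN.subset θ hθ)) T
  have hsum : ∑ t : Fin T, (1 + ‖(ω t).1‖) = ∑ t ∈ Finset.range T, (1 + ‖(ω t).1‖) :=
    Fin.sum_univ_eq_sum_range (fun t => 1 + ‖(ω t).1‖) T
  obtain ⟨θ₀, hθ₀⟩ := hN.nonempty
  have : Nonempty Θ := ⟨⟨θ₀, hN.subset θ₀ hθ₀⟩⟩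
  have hsup : ∀ ε : Fin T → Bool, ⨆ θ : Θ, ∑ t : Fin T, sign (ε t) * ℓ (τ.datum ε ω t) θ ≤
      U ε + δ * ∑ t ∈ Finset.range T, (1 + ‖(ω t).1‖) := by
    intro ε
    refine ciSup_le fun θ => ?_
    obtain ⟨θ', hθ', happ⟩ := hN.approx θ θ.2
    have h1 : ∑ t : Fin T, sign (ε t) * ℓ (τ.datum ε ω t) θ' ≤ U ε := hU ε θ' hθ'
    rw [← hsum, Finset.mul_sum]
    refine le_trans ?_ (add_le_add_left h1 _)
    rw [← Finset.sum_add_distrib]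
    refine Finset.sum_le_sum fun t _ => ?_
    have h2 := happ (τ.datum ε ω t) (τ.point_mem _ _ _) (τ.label_mem _ _ _)
    have h3 : |sign (ε t) * (ℓ (τ.datum ε ω t) θ - ℓ (τ.datum ε ω t) θ')| ≤
        δ * (1 + ‖(ω t).1‖) := by
      rw [abs_mul, abs_sign, one_mul]; exact h2
    linarith [(abs_le.1 h3).2, mul_sub (sign (ε t)) (ℓ (τ.datum ε ω t) θ) (ℓ (τ.datum ε ω t) θ')]
  calc (∑ ε : Fin T → Bool, ⨆ θ : Θ, ∑ t : Fin T, sign (ε t) * ℓ (τ.datum ε ω t) θ) / 2 ^ T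
      ≤ (∑ ε : Fin T → Bool, (U ε + δ * ∑ t ∈ Finset.range T, (1 + ‖(ω t).1‖))) / 2 ^ T := by
        gcongr with ε _
        exact hsup ε
    _ = (∑ ε, U ε) / 2 ^ T + δ * ∑ t ∈ Finset.range T, (1 + ‖(ω t).1‖) := by
        rw [Finset.sum_add_distrib, Finset.sum_const, Finset.card_univ, Fintype.card_fun,
          Fintype.card_bool, Fintype.card_fin, nsmul_eq_mul, add_div]
        push_cast
        rw [mul_div_cancel_left₀ _ (by positivity)]
    _ ≤ _ := by linarith

/-! ### Exponential weights -/

section ExpWeights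

variable {d : ℕ}

/-- The unnormalized exponential weight of a model after a history. -/
noncomputable def expWeight (ℓ : Datum d → Vec d → ℝ) (r : ℝ) {t : ℕ} (h : Fin t → Datum d)
    (θ : Vec d) : ℝ := Real.exp (-(r * ∑ i, ℓ (h i) θ))

lemma expWeight_pos {ℓ : Datum d → Vec d → ℝ} (r : ℝ) {t : ℕ} (h : Fin t → Datum d) (θ : Vec d) :
    0 < expWeight ℓ r h θ := Real.exp_pos _

/-- The exponential weights distribution on `N`. -/
noncomputable def expWeightMeasure (ℓ : Datum d → Vec d → ℝ) (N : Finset (Vec d)) (r : ℝ) {t : ℕ}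
    (h : Fin t → Datum d) : Measure (Vec d) :=
  ∑ θ ∈ N, ENNReal.ofReal (expWeight ℓ r h θ / ∑ θ' ∈ N, expWeight ℓ r h θ') • Measure.dirac θ

lemma sum_expWeight_pos {ℓ : Datum d → Vec d → ℝ} {N : Finset (Vec d)} (hN : N.Nonempty) (r : ℝ)
    {t : ℕ} (h : Fin t → Datum d) : 0 < ∑ θ ∈ N, expWeight ℓ r h θ :=
  Finset.sum_pos (fun _ _ => Real.exp_pos _) hN

lemma isProbabilityMeasure_expWeightMeasure {ℓ : Datum d → Vec d → ℝ} {N : Finset (Vec d)}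
    (hN : N.Nonempty) (r : ℝ) {t : ℕ} (h : Fin t → Datum d) :
    IsProbabilityMeasure (expWeightMeasure ℓ N r h) := by
  constructor
  have hW := sum_expWeight_pos (ℓ := ℓ) hN r h
  simp only [expWeightMeasure, Measure.finsetSum_apply, Measure.smul_apply, measure_univ,
    smul_eq_mul, mul_one]
  rw [← ENNReal.ofReal_sum_of_nonneg fun θ _ => div_nonneg (expWeight_pos r h θ).le hW.le,
    ← Finset.sum_div, div_self hW.ne', ENNReal.ofReal_one]

lemma expWeightMeasure_compl {ℓ : Datum d → Vec d → ℝ} {N : Finset (Vec d)} {Θ : Set (Vec d)}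
    (hN : ∀ θ ∈ N, θ ∈ Θ) (r : ℝ) {t : ℕ} (h : Fin t → Datum d) :
    expWeightMeasure ℓ N r h Θᶜ = 0 := by
  simp only [expWeightMeasure, Measure.finsetSum_apply, Measure.smul_apply, smul_eq_mul]
  refine Finset.sum_eq_zero fun θ hθ => ?_
  rw [Measure.dirac_apply]
  simp [hN θ hθ]

lemma integral_expWeightMeasure {ℓ : Datum d → Vec d → ℝ} {N : Finset (Vec d)} (hN : N.Nonempty)
    (r : ℝ) {t : ℕ} (h : Fin t → Datum d) (g : Vec d → ℝ) :
    ∫ θ, g θ ∂(expWeightMeasure ℓ N r h) =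
      (∑ θ ∈ N, expWeight ℓ r h θ * g θ) / ∑ θ ∈ N, expWeight ℓ r h θ := by
  have hW := sum_expWeight_pos (ℓ := ℓ) hN r h
  rw [expWeightMeasure, integral_finsetSum_measure fun θ _ =>
    (integrable_dirac (by simp)).smul_measure ENNReal.ofReal_ne_top, Finset.sum_div]
  refine Finset.sum_congr rfl fun θ _ => ?_
  rw [integral_smul_measure, integral_dirac,
    ENNReal.toReal_ofReal (div_nonneg (expWeight_pos r h θ).le hW.le), smul_eq_mul]
  ring

/-- The exponential weights learner. -/
noncomputable def expWeightLearner {ℓ : Datum d → Vec d → ℝ} {N : Finset (Vec d)}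
    {Θ : Set (Vec d)} (hℓ : ∀ θ, Measurable fun z => ℓ z θ) (hΘ : ∀ θ ∈ N, θ ∈ Θ)
    (hN : N.Nonempty) (r : ℝ) : Learner d Θ where
  predict t :=
    { toFun := expWeightMeasure ℓ N r
      measurable' := by
        have hw : ∀ θ, Measurable fun h : Fin t → Datum d => expWeight ℓ r h θ := fun θ => by
          have := hℓ θ
          unfold expWeight
          fun_prop
        refine Measure.measurable_of_measurable_coe _ fun s _ => ?_
        simp only [expWeightMeasure, Measure.finsetSum_apply, Measure.smul_apply, smul_eq_mul]
        fun_prop }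
  prob _ h := isProbabilityMeasure_expWeightMeasure hN r h
  supp _ h := expWeightMeasure_compl hΘ r h

/-- Take reciprocals in `1 + x + x² / 2 ≤ exp x`; the two quadratics multiply to `1 + x⁴ / 4`. -/
lemma exp_neg_le_quadratic {x : ℝ} (hx : 0 ≤ x) : Real.exp (-x) ≤ 1 - x + x ^ 2 / 2 := by
  have h1 := Real.quadratic_le_exp_of_nonneg hx
  have h2 : 0 < 1 - x + x ^ 2 / 2 := by nlinarith [sq_nonneg (x - 1)]
  rw [Real.exp_neg, inv_le_comm₀ (Real.exp_pos x) h2, inv_le_iff_one_le_mul₀ h2]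
  refine le_trans ?_ (mul_le_mul_of_nonneg_right h1 h2.le)
  nlinarith [sq_nonneg (x ^ 2)]

/-- The regret of exponential weights for losses in `[0, M]`. -/
lemma sum_integral_expWeightMeasure_le {ℓ : Datum d → Vec d → ℝ} {N : Finset (Vec d)} {M r : ℝ}
    (hr : 0 < r) {z : ℕ → Datum d} (h0 : ∀ t, ∀ θ ∈ N, 0 ≤ ℓ (z t) θ)
    (hM : ∀ t, ∀ θ ∈ N, ℓ (z t) θ ≤ M) {θ₀ : Vec d} (hθ₀ : θ₀ ∈ N) (T : ℕ) :
    ∑ t ∈ Finset.range T, ∫ θ, ℓ (z t) θ ∂(expWeightMeasure ℓ N r fun i : Fin t => z i) ≤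
      ∑ t ∈ Finset.range T, ℓ (z t) θ₀ + Real.log N.card / r + r * M ^ 2 * T / 2 := by
  have hN : N.Nonempty := ⟨θ₀, hθ₀⟩
  set W : ℕ → ℝ := fun t => ∑ θ ∈ N, expWeight ℓ r (fun i : Fin t => z i) θ with hW
  have hW0 : ∀ t, 0 < W t := fun t => sum_expWeight_pos hN r _
  set m : ℕ → ℝ := fun t => ∫ θ, ℓ (z t) θ ∂(expWeightMeasure ℓ N r fun i : Fin t => z i) with hm
  -- The total weight is the potential: each round shrinks it according to the mean loss `m t`, yet
  -- it always exceeds the single weight of `θ₀`.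
  have hstep : ∀ t, W (t + 1) ≤ W t * Real.exp (-(r * m t) + r ^ 2 * M ^ 2 / 2) := by
    intro t
    have h1 : ∀ θ ∈ N, expWeight ℓ r (fun i : Fin (t + 1) => z i) θ ≤
        expWeight ℓ r (fun i : Fin t => z i) θ * (1 + r ^ 2 * M ^ 2 / 2)
          - r * (expWeight ℓ r (fun i : Fin t => z i) θ * ℓ (z t) θ) := by
      intro θ hθ
      have h2 : expWeight ℓ r (fun i : Fin (t + 1) => z i) θ =
          expWeight ℓ r (fun i : Fin t => z i) θ * Real.exp (-(r * ℓ (z t) θ)) := by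
        simp only [expWeight]
        rw [← Real.exp_add, Fin.sum_univ_castSucc]
        congr 1
        simp only [Fin.val_castSucc, Fin.val_last]
        ring
      have h3 := exp_neg_le_quadratic (mul_nonneg hr.le (h0 t θ hθ))
      have h4 : (r * ℓ (z t) θ) ^ 2 ≤ r ^ 2 * M ^ 2 := by
        rw [mul_pow]
        exact mul_le_mul_of_nonneg_left (pow_le_pow_left₀ (h0 t θ hθ) (hM t θ hθ) 2) (sq_nonneg r)
      have h5 : 0 < expWeight ℓ r (fun i : Fin t => z i) θ := Real.exp_pos _
      rw [h2]
      calc _ ≤ expWeight ℓ r (fun i : Fin t => z i) θ *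
            (1 - r * ℓ (z t) θ + r ^ 2 * M ^ 2 / 2) :=
            mul_le_mul_of_nonneg_left (by linarith) h5.le
        _ = _ := by ring
    have h6 := Finset.sum_le_sum h1
    rw [Finset.sum_sub_distrib, ← Finset.sum_mul, ← Finset.mul_sum] at h6
    have h7 : ∑ θ ∈ N, expWeight ℓ r (fun i : Fin t => z i) θ * ℓ (z t) θ = W t * m t := by
      simp only [hm]
      rw [integral_expWeightMeasure hN, mul_div_cancel₀ _ (hW0 t).ne']
    rw [h7] at h6
    calc W (t + 1) ≤ W t * (-(r * m t) + r ^ 2 * M ^ 2 / 2 + 1) := h6.trans (le_of_eq (by ring))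
      _ ≤ _ := mul_le_mul_of_nonneg_left (Real.add_one_le_exp _) (hW0 t).le
  have htot : ∀ T : ℕ, W T ≤
      N.card * Real.exp (-(r * ∑ t ∈ Finset.range T, m t) + r ^ 2 * M ^ 2 / 2 * T) := by
    intro T
    induction T with
    | zero => simp [hW, expWeight]
    | succ T ih =>
      refine (hstep T).trans ((mul_le_mul_of_nonneg_right ih (Real.exp_pos _).le).trans
        (le_of_eq ?_))
      rw [mul_assoc, ← Real.exp_add, Finset.sum_range_succ]
      congr 2
      push_cast
      ring
  have hlow : Real.exp (-(r * ∑ t ∈ Finset.range T, ℓ (z t) θ₀)) ≤ W T := by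
    have h := Finset.single_le_sum (f := fun θ => expWeight ℓ r (fun i : Fin T => z i) θ)
      (fun _ _ => (Real.exp_pos _).le) hθ₀
    refine le_trans (le_of_eq ?_) h
    simp only [expWeight]
    rw [Fin.sum_univ_eq_sum_range fun t => ℓ (z t) θ₀]
  have hcard : (0 : ℝ) < N.card := by exact_mod_cast hN.card_pos
  have h := Real.log_le_log (Real.exp_pos _) (hlow.trans (htot T))
  rw [Real.log_exp, Real.log_mul hcard.ne' (Real.exp_pos _).ne', Real.log_exp] at h
  have h8 : r * ∑ t ∈ Finset.range T, m t ≤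
      r * (∑ t ∈ Finset.range T, ℓ (z t) θ₀ + Real.log N.card / r + r * M ^ 2 * T / 2) := by
    rw [mul_add, mul_add, mul_div_cancel₀ _ hr.ne']
    nlinarith
  exact le_of_mul_le_mul_left h8 hr

/-- Exponential weights on a net of the loss class have small online regret. -/
theorem onlineRegret_expWeightLearner_le {ℓ : Datum d → Vec d → ℝ} {B M : ℝ} {Θ : Set (Vec d)}
    {N : Finset (Vec d)} {δ : ℝ} (hℓ : ∀ θ, Measurable fun z => ℓ z θ)
    (hN : IsLossNet ℓ B Θ N δ) (hδ : 0 ≤ δ) (h0 : ∀ z θ, 0 ≤ ℓ z θ)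
    (hM : ∀ z : Datum d, z.1.1 ∈ actionPairs d → z.2 ∈ labels B → ∀ θ ∈ Θ, ℓ z θ ≤ M)
    {r : ℝ} (hr : 0 < r) (S : Nature d (actionPairs d) (labels B)) (T : ℕ) :
    onlineRegret (expWeightLearner hℓ hN.subset hN.nonempty r) ℓ S T ≤
      netBound d N.card M r δ T := by
  refine integral_le_netBound (by exact_mod_cast hN.nonempty.card_pos) hr hδ fun ω => ?_
  obtain ⟨θ₁, hθ₁⟩ := hN.nonempty
  have : Nonempty Θ := ⟨⟨θ₁, hN.subset θ₁ hθ₁⟩⟩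
  have hmem : ∀ t, (S.datum ω t).1.1 ∈ actionPairs d ∧ (S.datum ω t).2 ∈ labels B := fun t =>
    ⟨S.point_mem _ _, S.label_mem _ _⟩
  rw [sub_le_comm]
  refine le_ciInf fun θ => ?_
  obtain ⟨θ', hθ', happ⟩ := hN.approx θ θ.2
  have h1 := sum_integral_expWeightMeasure_le (ℓ := ℓ) (N := N) (M := M) hr (z := S.datum ω)
    (fun t θ _ => h0 _ θ)
    (fun t θ hθ => hM (S.datum ω t) (hmem t).1 (hmem t).2 θ (hN.subset θ hθ)) hθ' T
  have h2 : ∑ t ∈ Finset.range T, ℓ (S.datum ω t) θ' ≤ ∑ t ∈ Finset.range T, ℓ (S.datum ω t) θ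
      + δ * ∑ t ∈ Finset.range T, (1 + ‖(ω t).1‖) := by
    rw [Finset.mul_sum, ← Finset.sum_add_distrib]
    refine Finset.sum_le_sum fun t _ => ?_
    have h3 : |ℓ (S.datum ω t) θ - ℓ (S.datum ω t) θ'| ≤ δ * (1 + ‖(ω t).1‖) :=
      happ (S.datum ω t) (hmem t).1 (hmem t).2
    linarith [(abs_le.1 h3).1]
  change ∑ t ∈ Finset.range T, ∫ θ, ℓ (S.datum ω t) θ
    ∂(expWeightMeasure ℓ N r fun i : Fin t => S.datum ω i) - _ ≤ _
  linarith

end ExpWeights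

/-! ### From nets to global regret -/

section Main

variable {f f₁ f₂ : ℝ → ℝ} {c α μ : ℝ} {d : ℕ} {Θ : Set (Vec d)} {B ζg ζh : ℝ}

lemma IsRidgeProfile.measurable_loss (hf : IsRidgeProfile f f₁ f₂ c α μ) (κ₁ κ₂ : ℝ)
    (θ : Vec d) : Measurable fun z : Datum d => loss (regularized c (ridge f)) κ₁ κ₂ z θ := by
  have h := (hf.continuous_loss (d := d) κ₁ κ₂).comp (Continuous.prodMk_left θ)
  exact h.measurable

/-- Asking only for bounds by each `b' > b` covers the degenerate case `V = 0`, where the best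
threshold `ε` is `0` and is reached only as a limit. -/
lemma IsRidgeProfile.hasExpectedRegret_of_dispersion (hf : IsRidgeProfile f f₁ f₂ c α μ)
    (hΘ : ∀ θ ∈ Θ, ‖θ‖ = 1) {A : Set (Vec d)} (hA : ∀ a ∈ A, ‖a‖ ≤ 1) (hsub : ∀ θ ∈ Θ, θ ∈ A)
    (R : Learner d Θ) {T : ℕ} {b : ℝ}
    (h : ∀ θs ∈ Θ, ∀ a₀ ∈ A, ∀ act, IsArgmaxRule (regularized c (ridge f)) Θ act →
      ∃ V : ℝ, ∫ ω, ∑ t ∈ Finset.range T,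
          dispersion (regularized c (ridge f)) R act θs a₀ ω t ∂(noiseLaw d) ≤ V ∧
        ∀ b' > b, ∃ ε > 0, ε * T + 4 * (81 / 4 * c ^ 3 / μ) ^ 4 / ε ^ 7 * V ≤ b') :
    HasExpectedRegret (ridge f) (regularized c (ridge f)) A T R b := by
  intro θs hθs a₀ ha₀ act hact
  obtain ⟨hi, hle⟩ := hf.integral_globalRegret_le hΘ R hact hθs
    ((hA a₀ ha₀).trans one_le_two) hA (hsub θs hθs) T
  refine ⟨hi, ?_⟩
  obtain ⟨V, hV, hb⟩ := h θs hθs a₀ ha₀ act hact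
  refine le_of_forall_gt_imp_ge_of_dense fun b' hb' => ?_
  obtain ⟨ε, hε, hεb⟩ := hb b' hb'
  have hμ := hf.μ_pos
  have hc := hf.c_pos
  have := mul_le_mul_of_nonneg_left hV
    (by positivity : 0 ≤ 4 * (81 / 4 * c ^ 3 / μ) ^ 4 / ε ^ 7)
  linarith [hle ε hε]

/-- Without dispersion there is no regret. -/
lemma IsRidgeProfile.hasExpectedRegret_zero (hf : IsRidgeProfile f f₁ f₂ c α μ)
    (hΘ : ∀ θ ∈ Θ, ‖θ‖ = 1) {A : Set (Vec d)} (hA : ∀ a ∈ A, ‖a‖ ≤ 1) (hsub : ∀ θ ∈ Θ, θ ∈ A)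
    (R : Learner d Θ) {T : ℕ} (hT : T = 0 ∨ Θ.Subsingleton) :
    HasExpectedRegret (ridge f) (regularized c (ridge f)) A T R 0 := by
  refine hf.hasExpectedRegret_of_dispersion hΘ hA hsub R fun θs hθs a₀ _ act _ => ⟨0, ?_, ?_⟩
  · rcases hT with rfl | hT
    · simp
    · refine le_of_eq (integral_eq_zero_of_ae (.of_forall fun ω => ?_))
      refine Finset.sum_eq_zero fun t _ => integral_eq_zero_of_ae ?_
      -- In a one-element class every learner draws the ground truth.
      filter_upwards [R.ae_mem t _] with θ hθ
      simp [hT hθ hθs]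
  · intro b' hb'
    refine ⟨b' / (T + 1), by positivity, ?_⟩
    rw [mul_zero, add_zero, div_mul_eq_mul_div, div_le_iff₀ (by positivity)]
    nlinarith

/-- The constant in front of the regret rate. -/
noncomputable def regretConst (c α μ M D : ℝ) : ℝ :=
  1 + 4 * (81 / 4 * c ^ 3 / μ) ^ 4 * (2 * (2 * D + M ^ 2 / 2)) / (truncatedMoment * α ^ 2)

/-- An online regret of order `T ε ^ 8` bounds the total dispersion by the same order, and dividing
by `ε ^ 7` balances it with the term `ε T`. -/
lemma IsRidgeProfile.hasExpectedRegret_of_onlineRegret (hf : IsRidgeProfile f f₁ f₂ c α μ)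
    (hΘ : ∀ θ ∈ Θ, ‖θ‖ = 1) (hb : BoundedDerivs (regularized c (ridge f)) Θ B ζg ζh)
    {A : Set (Vec d)} (hA : ∀ a ∈ A, ‖a‖ ≤ 1) (hsub : ∀ θ ∈ Θ, θ ∈ A) {κ₂ : ℝ} (R : Learner d Θ)
    {T : ℕ} {ε M D : ℝ} (hε : 0 < ε)
    (h : ∀ N : Nature d (actionPairs d) (labels B),
      onlineRegret R (loss (regularized c (ridge f)) (2 * ζg) κ₂) N T ≤
        2 * (T * ε ^ 8 * (2 * D + M ^ 2 / 2))) :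
    HasExpectedRegret (ridge f) (regularized c (ridge f)) A T R
      (regretConst c α μ M D * (T * ε)) := by
  have hp : 0 < truncatedMoment * α ^ 2 := mul_pos truncatedMoment_pos (pow_pos hf.α_pos 2)
  refine hf.hasExpectedRegret_of_dispersion hΘ hA hsub R fun θs hθs a₀ ha₀ act hact =>
    ⟨2 * (T * ε ^ 8 * (2 * D + M ^ 2 / 2)) / (truncatedMoment * α ^ 2), ?_, fun b' hb' =>
      ⟨ε, hε, le_trans (le_of_eq ?_) hb'.le⟩⟩
  · rw [le_div_iff₀ hp, mul_comm]
    exact (hf.mul_integral_dispersion_le hΘ hb κ₂ R hact hθs ((hA a₀ ha₀).trans one_le_two) T).trans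
      (h _)
  · have hμ := hf.μ_pos
    rw [regretConst]
    generalize 4 * (81 / 4 * c ^ 3 / μ) ^ 4 = K
    generalize truncatedMoment * α ^ 2 = q at hp
    field_simp

/-- A finite net of the loss class yields the regret bound, for all learners with the online
guarantee and for exponential weights on the net. -/
theorem IsRidgeProfile.algorithmRegretBound_of_net (hf : IsRidgeProfile f f₁ f₂ c α μ)
    (hΘ : ∀ θ ∈ Θ, ‖θ‖ = 1) (hb : BoundedDerivs (regularized c (ridge f)) Θ B ζg ζh)
    {A : Set (Vec d)} (hA : ∀ a ∈ A, ‖a‖ ≤ 1) (hsub : ∀ θ ∈ Θ, θ ∈ A) {N : Finset (Vec d)}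
    {δ : ℝ} (hN : IsLossNet (loss (regularized c (ridge f)) (2 * ζg) (640 * √2 * ζh)) B Θ N δ)
    (hδ : 0 ≤ δ) {T : ℕ} {ε D : ℝ} (hε : 0 < ε) (hlog : Real.log N.card ≤ D * (T * ε ^ 16))
    (hδD : δ * (1 + d) ≤ D * ε ^ 8) :
    AlgorithmRegretBound (ridge f) (regularized c (ridge f)) A Θ B ζg ζh T
      (regretConst c α μ (8 * B ^ 2 + (2 * ζg) ^ 2 + (640 * √2 * ζh) ^ 2) D * (T * ε)) := by
  set M := 8 * B ^ 2 + (2 * ζg) ^ 2 + (640 * √2 * ζh) ^ 2 with hM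
  have hMb : ∀ z : Datum d, z.1.1 ∈ actionPairs d → z.2 ∈ labels B → ∀ θ ∈ Θ,
      loss (regularized c (ridge f)) (2 * ζg) (640 * √2 * ζh) z θ ≤ M := fun z hz hy θ hθ =>
    loss_le hb _ _ hz hy hθ
  have hℓ := hf.measurable_loss (d := d) (2 * ζg) (640 * √2 * ζh)
  -- At learning rate `ε ^ 8` each of the three terms has order `T ε ^ 8`; entropy and
  -- discretization contribute one `D` each.
  have hbound : netBound d N.card M (ε ^ 8) δ T ≤ T * ε ^ 8 * (2 * D + M ^ 2 / 2) := by
    have h1 : Real.log N.card / ε ^ 8 ≤ D * (T * ε ^ 8) := by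
      rw [div_le_iff₀ (by positivity)]
      exact hlog.trans (le_of_eq (by ring))
    have h2 := mul_le_mul_of_nonneg_right hδD (Nat.cast_nonneg (α := ℝ) T)
    rw [netBound]
    linarith
  have hbound0 : 0 ≤ netBound d N.card M (ε ^ 8) δ T := by
    have := Real.log_nonneg (show (1 : ℝ) ≤ N.card by exact_mod_cast hN.nonempty.card_pos)
    unfold netBound
    positivity
  refine ⟨fun R hR => ?_, expWeightLearner hℓ hN.subset hN.nonempty (ε ^ 8), ?_⟩
  · refine hf.hasExpectedRegret_of_onlineRegret hΘ hb hA hsub R hε fun S => (hR S).trans ?_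
    have := seqRademacher_le hN hδ (loss_nonneg _ _ _) hMb (pow_pos hε 8) T
    linarith
  · refine hf.hasExpectedRegret_of_onlineRegret hΘ hb hA hsub _ hε fun S =>
      (onlineRegret_expWeightLearner_le hℓ hN hδ (loss_nonneg _ _ _) hMb (pow_pos hε 8) S T).trans ?_
    linarith

lemma isLossNet_self {d : ℕ} (ℓ : Datum d → Vec d → ℝ) (B : ℝ) {Θ : Finset (Vec d)}
    (hΘ : Θ.Nonempty) : IsLossNet ℓ B (Θ : Set (Vec d)) Θ 0 where
  subset _ h := h
  nonempty := hΘ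
  approx θ hθ := ⟨θ, hθ, fun z _ _ => by simp⟩

/-- The value of `T ε` at the threshold `ε = (L / T) ^ (1 / 16)`. -/
lemma mul_rpow_div_eq {T L : ℝ} (hT : 0 < T) (hL : 0 ≤ L) :
    T * (L / T) ^ (1 / 16 : ℝ) = T ^ (15 / 16 : ℝ) * L ^ (1 / 16 : ℝ) := by
  rw [Real.div_rpow hL hT.le, mul_div_assoc', mul_comm T, mul_div_assoc, mul_comm]
  congr 1
  nth_rewrite 1 [← Real.rpow_one T]
  rw [← Real.rpow_sub hT]
  norm_num

lemma rpow_one_div_sixteen_pow {x : ℝ} (hx : 0 ≤ x) : (x ^ (1 / 16 : ℝ)) ^ 16 = x := by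
  rw [← Real.rpow_natCast, ← Real.rpow_mul hx]
  norm_num

/-- The regret bound for finite classes. -/
theorem IsRidgeProfile.algorithmRegretBound_finset (hf : IsRidgeProfile f f₁ f₂ c α μ)
    {Θ : Finset (Vec d)} (hne : Θ.Nonempty) (hΘ : ∀ θ ∈ Θ, ‖θ‖ = 1)
    (hb : BoundedDerivs (regularized c (ridge f)) (Θ : Set (Vec d)) B ζg ζh)
    {A : Set (Vec d)} (hA : ∀ a ∈ A, ‖a‖ ≤ 1) (hsub : ∀ θ ∈ Θ, θ ∈ A) (T : ℕ) :
    AlgorithmRegretBound (ridge f) (regularized c (ridge f)) A (Θ : Set (Vec d)) B ζg ζh T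
      (regretConst c α μ (8 * B ^ 2 + (2 * ζg) ^ 2 + (640 * √2 * ζh) ^ 2) 1 *
        (T : ℝ) ^ (15 / 16 : ℝ) * Real.log (Θ.card : ℝ) ^ (1 / 16 : ℝ)) := by
  have hN := isLossNet_self (loss (regularized c (ridge f)) (2 * ζg) (640 * √2 * ζh)) B hne
  -- Here the claimed bound is `0` and the threshold `ε` would not be positive.
  by_cases hT : T = 0 ∨ (Θ : Set (Vec d)).Subsingleton
  · have h0 : regretConst c α μ (8 * B ^ 2 + (2 * ζg) ^ 2 + (640 * √2 * ζh) ^ 2) 1 *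
        (T : ℝ) ^ (15 / 16 : ℝ) * Real.log (Θ.card : ℝ) ^ (1 / 16 : ℝ) = 0 := by
      rcases hT with rfl | hT
      · norm_num
      · have : Θ.card = 1 := le_antisymm
          (Finset.card_le_one.2 fun a ha b hb => hT ha hb) hne.card_pos
        norm_num [this]
    rw [h0]
    have hℓ := hf.measurable_loss (d := d) (2 * ζg) (640 * √2 * ζh)
    exact ⟨fun R _ => hf.hasExpectedRegret_zero hΘ hA hsub R hT,
      expWeightLearner hℓ hN.subset hne 1, hf.hasExpectedRegret_zero hΘ hA hsub _ hT⟩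
  · obtain ⟨hT0, hnt⟩ := not_or.1 hT
    have hTpos : (0 : ℝ) < T := by exact_mod_cast Nat.pos_of_ne_zero hT0
    have hcard : 1 < Θ.card := by
      by_contra! h
      exact hnt fun a ha b hb => Finset.card_le_one.1 h a ha b hb
    have hL : 0 < Real.log Θ.card := Real.log_pos (by exact_mod_cast hcard)
    rw [mul_assoc, ← mul_rpow_div_eq hTpos hL.le]
    have hε : 0 < (Real.log Θ.card / T) ^ (1 / 16 : ℝ) := Real.rpow_pos_of_pos (by positivity) _
    refine hf.algorithmRegretBound_of_net hΘ hb hA hsub hN le_rfl hε ?_ (by rw [zero_mul]; positivity)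
    rw [rpow_one_div_sixteen_pow (by positivity), mul_div_cancel₀ _ hTpos.ne', one_mul]

end Main

/-! ### Sparse models -/

/-- Coordinatewise rounding of sparse vectors takes few values, hence small nets exist. -/
lemma exists_sparse_net {d s k : ℕ} (hd : 1 ≤ d) (hs : 1 ≤ s) (hk : 1 ≤ k) :
    ∃ N : Finset (Vec d), (∀ θ ∈ N, θ ∈ sparseModels d s) ∧ N.Nonempty ∧
      N.card ≤ (d * (2 * k + 1)) ^ s ∧
      ∀ θ ∈ sparseModels d s, ∃ θ' ∈ N, ‖θ - θ'‖ ≤ d / k := by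
  classical
  have hk0 : (0 : ℝ) < k := by exact_mod_cast hk
  have hd0 : Nonempty (Fin d) := ⟨⟨0, hd⟩⟩
  set φ : Vec d → Fin d → ℤ := fun θ i => ⌊(k : ℝ) * θ i⌋ with hφ
  -- A code lists `s` pairs of a coordinate and its rounded value in `[-k, k]`, shifted by `k`;
  -- unlisted coordinates are `0`.
  set dec : (Fin s → Fin d × Fin (2 * k + 1)) → Fin d → ℤ := fun c i =>
    if h : ∃ j, (c j).1 = i then ((c h.choose).2 : ℤ) - k else 0 with hdec
  have hθ₀ : EuclideanSpace.single ⟨0, hd⟩ (1 : ℝ) ∈ sparseModels d s := by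
    refine ⟨le_trans (Set.ncard_le_ncard (t := {⟨0, hd⟩}) fun i hi => ?_) (by simpa using hs),
      by simp⟩
    by_contra h
    exact hi (by simp at h; simp [h])
  have hsurj : ∀ θ ∈ sparseModels d s, ∃ c, dec c = φ θ := by
    rintro θ ⟨hsupp, hnorm⟩
    set S : Finset (Fin d) := Finset.univ.filter fun i => θ i ≠ 0 with hS
    have hScard : S.card ≤ s := by
      rw [← Set.ncard_coe_finset]
      simpa [hS] using hsupp
    have hSne : Nonempty S := by
      by_contra h
      have : θ = 0 := by
        ext i
        by_contra hi
        exact h ⟨i, by simpa [hS] using hi⟩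
      simp [this] at hnorm
    obtain ⟨e⟩ := Function.Embedding.nonempty_of_card_le (α := S) (β := Fin s) (by simpa using hScard)
    have hbd : ∀ i, -(k : ℤ) ≤ φ θ i ∧ φ θ i ≤ k := by
      intro i
      have h1 : |θ i| ≤ 1 := by
        rw [← hnorm]; exact PiLp.norm_apply_le θ i
      have h2 := abs_le.1 h1
      constructor
      · rw [Int.le_floor]; push_cast; nlinarith
      · rw [← Int.lt_add_one_iff, Int.floor_lt]; push_cast; nlinarith
    -- Surplus slots repeat a support coordinate with its true value, so whichever slot the decoder
    -- chooses, the result agrees.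
    refine ⟨fun j => ((Function.invFun (⇑e) j).1,
      ⟨(φ θ (Function.invFun (⇑e) j).1 + k).toNat, ?_⟩), funext fun i => ?_⟩
    · have := hbd (Function.invFun (⇑e) j).1
      omega
    · simp only [hdec]
      split_ifs with h
      · have h1 := h.choose_spec
        have h2 := hbd i
        rw [h1]
        omega
      · have hi : i ∉ S := fun hi => h ⟨e ⟨i, hi⟩, by
          rw [Function.leftInverse_invFun e.injective]⟩
        have : θ i = 0 := by simpa [hS] using hi
        simp [hφ, this]
  -- Each realized code is represented by a sparse unit vector, since the rounded vector itself need
  -- not have norm one.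
  set rep : (Fin s → Fin d × Fin (2 * k + 1)) → Vec d := fun c =>
    if h : ∃ θ ∈ sparseModels d s, dec c = φ θ then h.choose
    else EuclideanSpace.single ⟨0, hd⟩ (1 : ℝ) with hrep
  refine ⟨Finset.univ.image rep, ?_, ?_, ?_, ?_⟩
  · intro θ hθ
    obtain ⟨c, -, rfl⟩ := Finset.mem_image.1 hθ
    simp only [hrep]
    split_ifs with h
    · exact h.choose_spec.1
    · exact hθ₀
  · obtain ⟨c, -⟩ := hsurj _ hθ₀
    exact ⟨rep c, Finset.mem_image_of_mem _ (Finset.mem_univ c)⟩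
  · refine Finset.card_image_le.trans (le_of_eq ?_)
    simp
  · intro θ hθ
    obtain ⟨c, hc⟩ := hsurj θ hθ
    have hex : ∃ θ ∈ sparseModels d s, dec c = φ θ := ⟨θ, hθ, hc⟩
    refine ⟨rep c, Finset.mem_image_of_mem _ (Finset.mem_univ c), ?_⟩
    have hr : rep c = hex.choose := by simp only [hrep]; rw [dif_pos hex]
    have hφeq : φ θ = φ (rep c) := by rw [← hc, hr]; exact hex.choose_spec.2
    have hcoord : ∀ i, |(θ - rep c) i| ≤ 1 / k := by
      intro i
      have h1 := Int.abs_sub_lt_one_of_floor_eq_floor (congrFun hφeq i)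
      rw [← mul_sub, abs_mul, abs_of_pos hk0] at h1
      rw [le_div_iff₀ hk0, mul_comm]
      exact h1.le
    have h1 : ‖θ - rep c‖ ≤ ∑ i, |(θ - rep c) i| := by
      rw [EuclideanSpace.norm_eq]
      refine Real.sqrt_le_iff.2 ⟨Finset.sum_nonneg fun i _ => abs_nonneg _, ?_⟩
      simp only [Real.norm_eq_abs]
      exact Finset.sum_sq_le_sq_sum_of_nonneg fun i _ => abs_nonneg _
    refine h1.trans ((Finset.sum_le_sum fun i _ => hcoord i).trans (le_of_eq ?_))
    simp
    rfl

/-- `min (κ²) (z²)` is the square of `min κ |z|`, which is 1-Lipschitz with values in `[0, κ]`.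
Clipping thus gives a Lipschitz constant although the third label coordinate is unbounded. -/
lemma abs_min_sq_sub_min_sq_le {κ : ℝ} (hκ : 0 ≤ κ) (x y : ℝ) :
    |min (κ ^ 2) (x ^ 2) - min (κ ^ 2) (y ^ 2)| ≤ 2 * κ * |x - y| := by
  have h : ∀ z : ℝ, min (κ ^ 2) (z ^ 2) = min κ |z| ^ 2 := by
    intro z
    rw [← sq_abs z]
    rcases le_total κ |z| with h | h
    · rw [min_eq_left h, min_eq_left (pow_le_pow_left₀ hκ h 2)]
    · rw [min_eq_right h, min_eq_right (pow_le_pow_left₀ (abs_nonneg z) h 2)]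
  have hx := le_min hκ (abs_nonneg x)
  have hy := le_min hκ (abs_nonneg y)
  have h1 : |(min κ (|x|)) - (min κ (|y|))| ≤ |x - y| :=
    (abs_min_sub_min_le_max κ (|x|) κ (|y|)).trans (by
      simpa using abs_abs_sub_abs_le_abs_sub x y)
  rw [h, h, sq_sub_sq, abs_mul, abs_of_nonneg (add_nonneg hx hy)]
  exact mul_le_mul (by linarith [min_le_left κ (|x|), min_le_left κ (|y|)]) h1 (abs_nonneg _)
    (by linarith)

lemma abs_sq_sub_sub_sq_sub_le {B p p' y : ℝ} (hp : |p| ≤ B) (hp' : |p'| ≤ B) (hy : |y| ≤ B) :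
    |(p - y) ^ 2 - (p' - y) ^ 2| ≤ 4 * B * |p - p'| := by
  rw [sq_sub_sq, abs_mul, show p - y - (p' - y) = p - p' by ring]
  refine mul_le_mul_of_nonneg_right ?_ (abs_nonneg _)
  rw [abs_le] at *
  constructor <;> linarith

/-- For linear rewards, the loss is Lipschitz in the model. -/
lemma abs_loss_sub_le {d : ℕ} {Θ : Set (Vec d)} {B ζg ζh : ℝ}
    (hb : BoundedDerivs (regularized 1 (ridge fun x => x)) Θ B ζg ζh) (κ₂ : ℝ) {θ θ' : Vec d}
    (hθ : θ ∈ Θ) (hθ' : θ' ∈ Θ) {z : Datum d} (hz : z.1.1 ∈ actionPairs d) (hy : z.2 ∈ labels B) :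
    |loss (regularized 1 (ridge fun x => x)) (2 * ζg) κ₂ z θ
        - loss (regularized 1 (ridge fun x => x)) (2 * ζg) κ₂ z θ'| ≤
      (16 * B + 4 * ζg) * ‖θ - θ'‖ * (1 + ‖z.1.2.1‖) := by
  have hB : 0 ≤ B := (abs_nonneg _).trans hy.1
  have hg : 0 ≤ ζg := (norm_nonneg _).trans (hb θ hθ _ hz.1).2.1
  obtain ⟨⟨⟨a, a'⟩, u, v⟩, y⟩ := z
  set η := regularized 1 (ridge (d := d) fun x => x) with hη
  have hin : ∀ w : Vec d, ‖w‖ ≤ 2 → |⟪θ, w⟫ - ⟪θ', w⟫| ≤ 2 * ‖θ - θ'‖ := fun w hw => by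
    rw [← inner_sub_left]
    refine (abs_real_inner_le_norm _ _).trans ?_
    rw [mul_comm]
    exact mul_le_mul_of_nonneg_right hw (norm_nonneg _)
  have h0 := abs_sq_sub_sub_sq_sub_le (hb θ hθ a hz.1).1 (hb θ' hθ' a hz.1).1 hy.1
  have h1 := abs_sq_sub_sub_sq_sub_le (hb θ hθ a' hz.2).1 (hb θ' hθ' a' hz.2).1 hy.2
  have hdiff : ∀ w, η θ w - η θ' w = ⟪θ, w⟫ - ⟪θ', w⟫ := fun w => by
    simp [hη, regularized, ridge]
  rw [hdiff] at h0 h1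
  have h2 := abs_min_sq_sub_min_sq_le (mul_nonneg zero_le_two hg)
    (predictLabel η θ ((a, a'), u, v) 2 - y 2) (predictLabel η θ' ((a, a'), u, v) 2 - y 2)
  have h2' : predictLabel η θ ((a, a'), u, v) 2 - y 2 - (predictLabel η θ' ((a, a'), u, v) 2 - y 2) =
      ⟪θ - θ', u⟫ := by
    rw [hη, isRidgeProfile_id.predictLabel_eq, isRidgeProfile_id.predictLabel_eq, inner_sub_left]
    simp
  -- For a linear reward the Hessian comes from the penalty alone, so the fourth terms of the two
  -- losses cancel.
  have h3 : predictLabel η θ ((a, a'), u, v) 3 = predictLabel η θ' ((a, a'), u, v) 3 := by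
    rw [hη, isRidgeProfile_id.predictLabel_eq, isRidgeProfile_id.predictLabel_eq]
    simp
  rw [h2'] at h2
  have h2'' := mul_le_mul_of_nonneg_left (abs_real_inner_le_norm (θ - θ') u)
    (by positivity : 0 ≤ 2 * (2 * ζg))
  have h0' := mul_le_mul_of_nonneg_left (hin a hz.1) (by positivity : 0 ≤ 4 * B)
  have h1' := mul_le_mul_of_nonneg_left (hin a' hz.2) (by positivity : 0 ≤ 4 * B)
  have hBu : 0 ≤ B * ‖θ - θ'‖ * ‖u‖ := by positivity
  have hgn : 0 ≤ ζg * ‖θ - θ'‖ := by positivity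
  simp only [loss, h3]
  have e0 : predictLabel η θ ((a, a'), u, v) 0 = η θ a := rfl
  have e0' : predictLabel η θ' ((a, a'), u, v) 0 = η θ' a := rfl
  have e1 : predictLabel η θ ((a, a'), u, v) 1 = η θ a' := rfl
  have e1' : predictLabel η θ' ((a, a'), u, v) 1 = η θ' a' := rfl
  rw [e0, e0', e1, e1']
  simp only at h0 h1 h2 ⊢
  have hR : (16 * B + 4 * ζg) * ‖θ - θ'‖ * (1 + ‖u‖) = 4 * B * (2 * ‖θ - θ'‖)
      + 4 * B * (2 * ‖θ - θ'‖) + 2 * (2 * ζg) * (‖θ - θ'‖ * ‖u‖) + 4 * (ζg * ‖θ - θ'‖)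
      + 16 * (B * ‖θ - θ'‖ * ‖u‖) := by ring
  rw [hR]
  rw [abs_le] at h0 h1 h2 ⊢
  constructor <;> linarith

/-- The regret bound for sparse classes. -/
theorem algorithmRegretBound_sparse {B ζg ζh : ℝ} {d s : ℕ} (hd : 1 ≤ d) (hs : 1 ≤ s)
    (hb : BoundedDerivs (regularized 1 (ridge fun x => x)) (sparseModels d s) B ζg ζh) (T : ℕ) :
    AlgorithmRegretBound (ridge fun x => x) (regularized 1 (ridge fun x => x))
      (Metric.closedBall 0 1) (sparseModels d s) B ζg ζh T
      (regretConst 1 1 1 (8 * B ^ 2 + (2 * ζg) ^ 2 + (640 * √2 * ζh) ^ 2)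
          (3 + 4 * (16 * B + 4 * ζg)) * (T : ℝ) ^ (15 / 16 : ℝ) * (s : ℝ) ^ (1 / 16 : ℝ)
        * Real.log (2 * d * T : ℝ) ^ (1 / 16 : ℝ)) := by
  have hΘ : ∀ θ ∈ sparseModels d s, ‖θ‖ = 1 := fun θ h => h.2
  have hA : ∀ a ∈ Metric.closedBall (0 : Vec d) 1, ‖a‖ ≤ 1 := fun a ha => by simpa using ha
  have hsub : ∀ θ ∈ sparseModels d s, θ ∈ Metric.closedBall (0 : Vec d) 1 := fun θ h => by
    simp [h.2]
  -- The mesh `k = d² T` brings the discretization error per round down to order `1 / T`, including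
  -- the factor `1 + d` from the noise. For `T = 0` any positive mesh serves.
  obtain ⟨k, hk1, hkeq⟩ : ∃ k : ℕ, 1 ≤ k ∧ (T ≠ 0 → k = d * d * T) := by
    rcases Nat.eq_zero_or_pos T with rfl | hT
    · exact ⟨1, le_rfl, by simp⟩
    · exact ⟨d * d * T, Nat.mul_pos (Nat.mul_pos hd hd) hT, fun _ => rfl⟩
  obtain ⟨N, hNsub, hNne, hNcard, hNapp⟩ := exists_sparse_net hd hs hk1
  obtain ⟨θ₀, hθ₀⟩ := hNne
  have hb0 := hb θ₀ (hNsub θ₀ hθ₀) 0 (by simp)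
  have hB : 0 ≤ B := (abs_nonneg _).trans hb0.1
  have hg : 0 ≤ ζg := (norm_nonneg _).trans hb0.2.1
  have hE : 0 ≤ 16 * B + 4 * ζg := by positivity
  have hN : IsLossNet (loss (regularized 1 (ridge fun x => x)) (2 * ζg) (640 * √2 * ζh)) B
      (sparseModels d s) N ((16 * B + 4 * ζg) * (d / k)) :=
    { subset := hNsub
      nonempty := ⟨θ₀, hθ₀⟩
      approx := fun θ hθ => by
        obtain ⟨θ', hθ', hdist⟩ := hNapp θ hθ
        refine ⟨θ', hθ', fun z hz hy =>
          (abs_loss_sub_le hb _ hθ (hNsub θ' hθ') hz hy).trans ?_⟩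
        exact mul_le_mul_of_nonneg_right (mul_le_mul_of_nonneg_left hdist hE) (by positivity) }
  have hδ : 0 ≤ (16 * B + 4 * ζg) * ((d : ℝ) / k) := by positivity
  rcases Nat.eq_zero_or_pos T with rfl | hT
  · have hℓ := isRidgeProfile_id.measurable_loss (d := d) (2 * ζg) (640 * √2 * ζh)
    norm_num
    exact ⟨fun R _ => isRidgeProfile_id.hasExpectedRegret_zero hΘ hA hsub R (.inl rfl),
      expWeightLearner hℓ hNsub ⟨θ₀, hθ₀⟩ 1,
      isRidgeProfile_id.hasExpectedRegret_zero hΘ hA hsub _ (.inl rfl)⟩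
  · have hk := hkeq hT.ne'
    have hT1 : (1 : ℝ) ≤ T := by exact_mod_cast hT
    have hd1 : (1 : ℝ) ≤ d := by exact_mod_cast hd
    have hs1 : (1 : ℝ) ≤ s := by exact_mod_cast hs
    have hT0 : (0 : ℝ) < T := by linarith
    have hdT : (1 : ℝ) ≤ d * T := by nlinarith
    have hlog : 1 / 4 ≤ Real.log (2 * d * T) := by
      have h1 : Real.log 2 ≤ Real.log (2 * d * T) := Real.log_le_log two_pos (by nlinarith)
      linarith [Real.log_two_gt_d9]
    set L : ℝ := s * Real.log (2 * d * T) with hL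
    have hL0 : 1 / 4 ≤ L := by nlinarith
    have hLT : 0 < L / T := by positivity
    rw [mul_assoc, ← Real.mul_rpow (by positivity) (by linarith), ← hL, mul_assoc,
      ← mul_rpow_div_eq hT0 (by linarith)]
    have hε : 0 < (L / T) ^ (1 / 16 : ℝ) := Real.rpow_pos_of_pos hLT _
    have hε16 : ((L / T) ^ (1 / 16 : ℝ)) ^ 16 = L / T := rpow_one_div_sixteen_pow hLT.le
    refine isRidgeProfile_id.algorithmRegretBound_of_net hΘ hb hA hsub hN hδ hε ?_ ?_
    · rw [hε16, mul_div_cancel₀ _ hT0.ne']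
      -- `d (2 d² T + 1) ≤ 3 d³ T ≤ (2 d T)³`; the cube accounts for the `3` in the constant.
      have h1 : (N.card : ℝ) ≤ ((2 * d * T : ℝ) ^ 3) ^ s := by
        have h2 : (N.card : ℝ) ≤ (d * (2 * k + 1)) ^ s := by exact_mod_cast hNcard
        refine h2.trans (pow_le_pow_left₀ (by positivity) ?_ s)
        rw [hk]
        push_cast
        have h3 : (d : ℝ) ≤ d ^ 3 * T := by
          calc (d : ℝ) = d * 1 := (mul_one _).symm
            _ ≤ d * (d ^ 2 * T) := by
              refine mul_le_mul_of_nonneg_left ?_ (by positivity)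
              nlinarith
            _ = d ^ 3 * T := by ring
        have h4 : (d : ℝ) ^ 3 * T ≤ d ^ 3 * T ^ 3 :=
          mul_le_mul_of_nonneg_left (le_self_pow₀ hT1 (by norm_num)) (by positivity)
        nlinarith
      have h2 := Real.log_le_log (by exact_mod_cast Finset.card_pos.2 ⟨θ₀, hθ₀⟩) h1
      rw [Real.log_pow, Real.log_pow] at h2
      push_cast at h2
      have h3 : 0 ≤ 4 * (16 * B + 4 * ζg) * L := by positivity
      rw [hL] at h3 ⊢
      linarith
    -- `ε ^ 8` is the square root of `L / T`, and `L ≥ 1/4`, `T ≥ 1` give `L / T ≥ 1 / (2T)²`. The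
    -- error `2 / T` is four times `1 / (2T)`, whence the `4` in the constant.
    · have h1 : 1 / (2 * T) ≤ ((L / T) ^ (1 / 16 : ℝ)) ^ 8 := by
        refine le_of_sq_le_sq ?_ (by positivity)
        rw [← pow_mul, hε16, div_pow, div_le_div_iff₀ (by positivity) hT0]
        nlinarith
      have h2 : (d : ℝ) / k * (1 + d) ≤ 2 / T := by
        rw [hk]
        push_cast
        rw [div_mul_eq_mul_div, div_le_div_iff₀ (by positivity) hT0]
        nlinarith [mul_le_mul_of_nonneg_right (by nlinarith : (d : ℝ) * (1 + d) ≤ 2 * (d * d)) hT0.le]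
      calc (16 * B + 4 * ζg) * ((d : ℝ) / k) * (1 + d)
          = (16 * B + 4 * ζg) * ((d : ℝ) / k * (1 + d)) := by ring
        _ ≤ (16 * B + 4 * ζg) * (2 / T) := mul_le_mul_of_nonneg_left h2 hE
        _ = 4 * (16 * B + 4 * ζg) * (1 / (2 * T)) := by field_simp; ring
        _ ≤ (3 + 4 * (16 * B + 4 * ζg)) * (1 / (2 * T)) :=
            mul_le_mul_of_nonneg_right (by linarith) (by positivity)
        _ ≤ _ := mul_le_mul_of_nonneg_left h1 (by linarith)

end ViOlin

/-! ### The three bandit problems -/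

theorem mainTheorem9 (B ζg ζh : ℝ) :
    -- linear bandit on the unit ball, finite model class on the unit sphere
    (∃ C : ℝ, ∀ (d : ℕ) (Θ : Finset (ViOlin.Vec d)), Θ.Nonempty → (∀ θ ∈ Θ, ‖θ‖ = 1) →
      ViOlin.BoundedDerivs (ViOlin.regularized 1 ViOlin.linearReward) (Θ : Set (ViOlin.Vec d))
        B ζg ζh →
      ∀ T : ℕ, ViOlin.AlgorithmRegretBound ViOlin.linearReward
        (ViOlin.regularized 1 ViOlin.linearReward) (Metric.closedBall 0 1)
        (Θ : Set (ViOlin.Vec d)) B ζg ζh T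
        (C * (T : ℝ) ^ (15 / 16 : ℝ) * Real.log (Θ.card : ℝ) ^ (1 / 16 : ℝ))) ∧
    -- linear bandit on the unit ball, all sparse vectors of the unit sphere
    (∃ C : ℝ, ∀ d s : ℕ, 1 ≤ d → 1 ≤ s →
      ViOlin.BoundedDerivs (ViOlin.regularized 1 ViOlin.linearReward) (ViOlin.sparseModels d s)
        B ζg ζh →
      ∀ T : ℕ, ViOlin.AlgorithmRegretBound ViOlin.linearReward
        (ViOlin.regularized 1 ViOlin.linearReward) (Metric.closedBall 0 1)
        (ViOlin.sparseModels d s) B ζg ζh T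
        (C * (T : ℝ) ^ (15 / 16 : ℝ) * (s : ℝ) ^ (1 / 16 : ℝ)
          * Real.log (2 * d * T : ℝ) ^ (1 / 16 : ℝ))) ∧
    -- logistic bandit on the unit sphere, finite model class on the unit sphere
    (∃ C : ℝ, ∀ (d : ℕ) (Θ : Finset (ViOlin.Vec d)), Θ.Nonempty → (∀ θ ∈ Θ, ‖θ‖ = 1) →
      ViOlin.BoundedDerivs (ViOlin.regularized ViOlin.logisticConst ViOlin.logisticReward)
        (Θ : Set (ViOlin.Vec d)) B ζg ζh →
      ∀ T : ℕ, ViOlin.AlgorithmRegretBound ViOlin.logisticReward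
        (ViOlin.regularized ViOlin.logisticConst ViOlin.logisticReward) (Metric.sphere 0 1)
        (Θ : Set (ViOlin.Vec d)) B ζg ζh T
        (C * (T : ℝ) ^ (15 / 16 : ℝ) * Real.log (Θ.card : ℝ) ^ (1 / 16 : ℝ))) := by
  refine ⟨⟨ViOlin.regretConst 1 1 1 (8 * B ^ 2 + (2 * ζg) ^ 2 + (640 * √2 * ζh) ^ 2) 1,
      fun d Θ hne hΘ hb T => ?_⟩,
    ⟨ViOlin.regretConst 1 1 1 (8 * B ^ 2 + (2 * ζg) ^ 2 + (640 * √2 * ζh) ^ 2)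
      (3 + 4 * (16 * B + 4 * ζg)), fun d s hd hs hb T => ?_⟩,
    ⟨ViOlin.regretConst ViOlin.logisticConst (1 / 20) (1 / 20)
      (8 * B ^ 2 + (2 * ζg) ^ 2 + (640 * √2 * ζh) ^ 2) 1, fun d Θ hne hΘ hb T => ?_⟩⟩
  -- The linear and logistic rewards are ridge rewards by definition, for the identity and for
  -- `Real.sigmoid`.
  · exact ViOlin.isRidgeProfile_id.algorithmRegretBound_finset hne hΘ hb
      (fun a ha => by simpa using ha) (fun θ hθ => by simp [hΘ θ hθ]) T
  · exact ViOlin.algorithmRegretBound_sparse hd hs hb T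
  · exact ViOlin.isRidgeProfile_sigmoid.algorithmRegretBound_finset hne hΘ hb
      (fun a ha => (mem_sphere_zero_iff_norm.1 ha).le)
      (fun θ hθ => mem_sphere_zero_iff_norm.2 (hΘ θ hθ)) T
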